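/- Let $\Sigma=\{0,1,\#\}$ and, for $n\ge 1$, let $L_{\mathrm{EQ}}(n)=\{x\#^n y : x,y\in\{0,1\}^n,\ x=y\}\subseteq\Sigma^*$. A two-way deterministic (2DFA) or probabilistic (2PFA) finite automaton $M=(S,\Sigma,\delta,s_0,S_{acc},S_{rej})$, with $S$ finite and $S_{acc}\cap S_{rej}=\emptyset$, starts in state $s_0$ with its head on the left end-marker of the tape ¢$\,w\,\$$. In each step it changes its state and moves its head by $-1$, $0$ or $1$, without leaving the tape, according to its state and the symbol it reads: deterministically for a 2DFA, and with a given probability for each pair (new state, move) for a 2PFA. It halts when its state lies in $S_{acc}\cup S_{rej}$, and then accepts or rejects $w$ accordingly. A 2DFA recognizes $L$ if it accepts every $w\in L$ and rejects every $w\notin L$. A 2PFA recognizes $L$ with error $\epsilon$ if it accepts every $w\in L$ with probability at least $1-\epsilon$ and every $w\notin L$ with probability at most $\epsilon$. If $M$ recognizes $L$ (with error $\epsilon$), let $T(M)\in\mathbb N\cup\{\infty\}$ be the supremum of the numbers of steps of the accepting computations of $M$ (for a 2PFA: of those that have positive probability) on words $w\in L$. Let $TS(M)=T(M)\cdot\log_2|S|$.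 Let $TS_{2DFA}(L)$ be the infimum of $TS(M)$ over all 2DFAs $M$ that recognize $L$, and let $TS_{2PFA,\epsilon}(L)$ be the infimum over all 2PFAs $M$ that recognize $L$ with error $\epsilon$. **Theorem.** (1) $TS_{2DFA}(L_{\mathrm{EQ}}(n))=\Theta(n^2)$: there are constants $c,C>0$ such that $c\,n^2\le TS_{2DFA}(L_{\mathrm{EQ}}(n))\le C\,n^2$ for all $n\ge 1$. (2) With bounded error, $TS_{2PFA}(L_{\mathrm{EQ}}(n))=\Theta(n\log n)$: for every $\epsilon\in(0,1/2)$ there are constants $c,C>0$, depending only on $\epsilon$, such that $c\,n\log_2 n\le TS_{2PFA,\epsilon}(L_{\mathrm{EQ}}(n))\le C\,n\log_2 n$ for all $n\ge 2$. -/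

import Mathlib

open scoped ENNReal

/-- The symbols that a head can read: the left end-marker, an input symbol, the right
end-marker. -/
inductive TapeSymbol (α : Type) : Type
  | leftEnd : TapeSymbol α
  | letter : α → TapeSymbol α
  | rightEnd : TapeSymbol α

/-- The symbol at position `i` of the tape `¢ w $`: the left end-marker is at position `0`, the
letters of `w` are at positions `1, …, |w|` and the right end-marker is at position `|w| + 1`. -/
def tapeSymbol {α : Type} (w : List α) : ℕ → TapeSymbol α
  | 0 => TapeSymbol.leftEnd
  | i + 1 =>
    match w[i]? with
    | some a => TapeSymbol.letter a
    | none => TapeSymbol.rightEnd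

/-- The head position after a move in direction `d ∈ {-1, 0, 1}`. The automata below never move to
the left from position `0`. -/
def movedHead (i : ℕ) : SignType → ℕ
  | SignType.neg => i - 1
  | SignType.zero => i
  | SignType.pos => i + 1

/-- A two-way deterministic finite automaton over the alphabet `α` with set of states `S`. Its
head does not leave the tape. -/
structure TwoDFA (α S : Type) where
  /-- the transition function -/
  δ : S → TapeSymbol α → S × SignType
  /-- the initial state -/
  start : S
  /-- the accepting states -/
  acc : Set S
  /-- the rejecting states -/
  rej : Set S
  disjoint_acc_rej : Disjoint acc rej
  leftEnd_ne : ∀ s, (δ s TapeSymbol.leftEnd).2 ≠ -1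
  rightEnd_ne : ∀ s, (δ s TapeSymbol.rightEnd).2 ≠ 1

namespace TwoDFA

variable {α S : Type}

open Classical in
/-- One step on input `w`, on configurations (state, head position). The automaton halts as soon as
its state is accepting or rejecting: such a configuration is not changed. -/
noncomputable def step (M : TwoDFA α S) (w : List α) (c : S × ℕ) : S × ℕ :=
  if c.1 ∈ M.acc ∪ M.rej then c
  else ((M.δ c.1 (tapeSymbol w c.2)).1, movedHead c.2 (M.δ c.1 (tapeSymbol w c.2)).2)

/-- The configuration after `t` steps on input `w`. -/
noncomputable def config (M : TwoDFA α S) (w : List α) (t : ℕ) : S × ℕ :=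
  (M.step w)^[t] (M.start, 0)

/-- The automaton halts on `w` in an accepting state. -/
def Accepts (M : TwoDFA α S) (w : List α) : Prop := ∃ t, (M.config w t).1 ∈ M.acc

/-- The automaton halts on `w` in a rejecting state. -/
def Rejects (M : TwoDFA α S) (w : List α) : Prop := ∃ t, (M.config w t).1 ∈ M.rej

/-- The automaton accepts every word of `L` and rejects every other word. -/
def Recognizes (M : TwoDFA α S) (L : Language α) : Prop :=
  (∀ w, w ∈ L → M.Accepts w) ∧ (∀ w, w ∉ L → M.Rejects w)

/-- The number of steps that the automaton makes on `w` until it accepts. -/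
noncomputable def acceptTime (M : TwoDFA α S) (w : List α) : ℕ∞ :=
  ⨅ (t : ℕ) (_ : (M.config w t).1 ∈ M.acc), (t : ℕ∞)

/-- The time complexity of an automaton that recognizes `L`: the maximal number of steps it takes
to accept a word of `L`. -/
noncomputable def time (M : TwoDFA α S) (L : Language α) : ℕ∞ :=
  ⨆ w ∈ L, M.acceptTime w

/-- Time times space, where the space is the binary logarithm of the number of states. -/
noncomputable def timeSpace [Fintype S] (M : TwoDFA α S) (L : Language α) : ℝ≥0∞ :=
  (M.time L : ℝ≥0∞) * ENNReal.ofReal (Real.logb 2 (Fintype.card S))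

end TwoDFA

/-- A two-way probabilistic finite automaton over the alphabet `α` with set of states `S`. Its
head does not leave the tape. -/
structure TwoPFA (α S : Type) where
  /-- `δ s a (s', d)` is the probability to change the state to `s'` and to move the head in
  direction `d`, if the state is `s` and the head reads `a` -/
  δ : S → TapeSymbol α → PMF (S × SignType)
  /-- the initial state -/
  start : S
  /-- the accepting states -/
  acc : Set S
  /-- the rejecting states -/
  rej : Set S
  disjoint_acc_rej : Disjoint acc rej
  leftEnd_eq_zero : ∀ s s', δ s TapeSymbol.leftEnd (s', -1) = 0
  rightEnd_eq_zero : ∀ s s', δ s TapeSymbol.rightEnd (s', 1) = 0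

namespace TwoPFA

variable {α S : Type}

open Classical in
/-- The law of the configuration one step after the configuration `c` (state, head position) on
input `w`. The automaton halts as soon as its state is accepting or rejecting. -/
noncomputable def step (M : TwoPFA α S) (w : List α) (c : S × ℕ) : PMF (S × ℕ) :=
  if c.1 ∈ M.acc ∪ M.rej then PMF.pure c
  else (M.δ c.1 (tapeSymbol w c.2)).map fun p => (p.1, movedHead c.2 p.2)

/-- The law of the configuration after `t` steps on input `w`. -/
noncomputable def law (M : TwoPFA α S) (w : List α) : ℕ → PMF (S × ℕ)
  | 0 => PMF.pure (M.start, 0)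
  | t + 1 => (M.law w t).bind (M.step w)

/-- The probability that the automaton has halted on `w` in an accepting state after at most `t`
steps. -/
noncomputable def acceptProbWithin (M : TwoPFA α S) (w : List α) (t : ℕ) : ℝ≥0∞ :=
  (M.law w t).toOuterMeasure {c | c.1 ∈ M.acc}

/-- The probability that the automaton halts on `w` in an accepting state. -/
noncomputable def acceptProb (M : TwoPFA α S) (w : List α) : ℝ≥0∞ :=
  ⨆ t, M.acceptProbWithin w t

/-- The automaton recognizes `L` with error `ε`. -/
def Recognizes (M : TwoPFA α S) (ε : ℝ) (L : Language α) : Prop :=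
  (∀ w, w ∈ L → ENNReal.ofReal (1 - ε) ≤ M.acceptProb w) ∧
    (∀ w, w ∉ L → M.acceptProb w ≤ ENNReal.ofReal ε)

/-- `M.Reaches w t c`: some computation on `w`, all of whose transitions have positive
probability, is in the configuration `c` after exactly `t` steps (and has not halted before). -/
inductive Reaches (M : TwoPFA α S) (w : List α) : ℕ → S × ℕ → Prop
  | start : Reaches M w 0 (M.start, 0)
  | step {t : ℕ} {s : S} {i : ℕ} {s' : S} {d : SignType} :
      Reaches M w t (s, i) → s ∉ M.acc ∪ M.rej →
      M.δ s (tapeSymbol w i) (s', d) ≠ 0 → Reaches M w (t + 1) (s', movedHead i d)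

/-- The time complexity of an automaton that recognizes `L`: the maximal number of steps it takes
to accept a word of `L`, over all words of `L` and all accepting computations of positive
probability. -/
noncomputable def time (M : TwoPFA α S) (L : Language α) : ℕ∞ :=
  ⨆ (w ∈ L) (t : ℕ) (_ : ∃ c, M.Reaches w t c ∧ c.1 ∈ M.acc), (t : ℕ∞)

/-- Time times space, where the space is the binary logarithm of the number of states. -/
noncomputable def timeSpace [Fintype S] (M : TwoPFA α S) (L : Language α) : ℝ≥0∞ :=
  (M.time L : ℝ≥0∞) * ENNReal.ofReal (Real.logb 2 (Fintype.card S))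

end TwoPFA

/-- The 2DFA time-space complexity of `L`: the infimum over all 2DFAs that recognize `L`. -/
noncomputable def ts2DFA {α : Type} (L : Language α) : ℝ≥0∞ :=
  ⨅ (S : Type) (_ : Fintype S) (M : TwoDFA α S) (_ : M.Recognizes L), M.timeSpace L

/-- The 2PFA time-space complexity of `L` with error `ε`: the infimum over all 2PFAs that
recognize `L` with error `ε`. -/
noncomputable def ts2PFA {α : Type} (ε : ℝ) (L : Language α) : ℝ≥0∞ :=
  ⨅ (S : Type) (_ : Fintype S) (M : TwoPFA α S) (_ : M.Recognizes ε L), M.timeSpace L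

/-- The alphabet `{0, 1, #}`. -/
inductive Letter : Type
  | bit : Bool → Letter
  | hash : Letter

/-- The language `{x #ⁿ y : x, y ∈ {0,1}ⁿ, x = y}`. -/
def languageEQ (n : ℕ) : Language Letter :=
  {w | ∃ x y : List Bool, x.length = n ∧ y.length = n ∧ x = y ∧
    w = x.map Letter.bit ++ List.replicate n Letter.hash ++ y.map Letter.bit}

/-! The lower bounds rest on crossing sequences at a cut inside the block of `#`. For a
probabilistic automaton with `s` states, the weight of the accepting computations with a given
crossing sequence `σ` is a product of a weight of the left part and a weight of the right part
(`crossExp_le_mul`, `mul_le_crossExp`). A step crosses at most one of `n` cuts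
(`sum_crossExp_length_le`), so if accepting takes at most `T` steps, some cut has expected crossing
length at most `T/n`. By Markov's inequality, sequences longer than some `m` of order `T/n` carry
little weight. Hence at least `2^n/n` words `x` share a cut for which the matrix `∑ σ, P x σ * Q y
σ` over short `σ` is large on the diagonal and bounded everywhere by the acceptance probability of
`x #ⁿ y` (`exists_crossing_weights`).

Without error, two words whose diagonal entries use the same `σ` would give a false acceptance. So
`2^n/n` is at most the number `s^O(m)` of short sequences, and `n² = O(T log s)`. With bounded
error, only an approximate identity matrix is available. Rounding its rows bounds their number by
`O(K)^K`, where `K` counts the sequences (`card_le_pow_of_approx_identity`). This leaves `n =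
O(K²)`, that is `n log n = O(T log s)` for large `n`. A deterministic automaton is treated as a
probabilistic one without error.

Both upper bounds use one sweep over the tape. The deterministic automaton stores the whole word.
The probabilistic one picks a random point `r` of a field with `Θ(n)` elements and evaluates at `r`
the polynomial with coefficients `xᵢ - yᵢ`, which needs only polynomially many states. -/

namespace TwoPFA

/-! ### Crossing sequences and the factorization at a cut. -/

variable {α S : Type} [Fintype S]

open Classical in
/-- The expectation of `g σ` on the event that `M` accepts within `t` steps from the configuration
`c`, where `σ` is the sequence of the states in which the head enters or leaves the set `I` of
positions. -/
noncomputable def crossExp (M : TwoPFA α S) (w : List α) (I : Set ℕ) :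
    ℕ → S × ℕ → (List S → ℝ≥0∞) → ℝ≥0∞
  | 0, c, g => if c.1 ∈ M.acc then g [] else 0
  | t + 1, c, g =>
    if c.1 ∈ M.acc ∪ M.rej then (if c.1 ∈ M.acc then g [] else 0)
    else ∑ p : S × SignType, M.δ c.1 (tapeSymbol w c.2) p *
      crossExp M w I t (p.1, movedHead c.2 p.2)
        (if (c.2 ∈ I ↔ movedHead c.2 p.2 ∈ I) then g else fun σ => g (p.1 :: σ))

open Classical in
/-- The weight of the part of a computation that takes place in the set `I` of positions, if it
starts in the configuration `c` and has at most `t` steps between crossings: the head leaves `I` and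
returns to `I` (at the position `e`) in the states that `σ` prescribes. -/
noncomputable def sideWeight (M : TwoPFA α S) (w : List α) (I : Set ℕ) (e : ℕ) :
    ℕ → S × ℕ → List S → ℝ≥0∞
  | 0, c, σ => if c.1 ∈ M.acc ∧ σ = [] then 1 else 0
  | t + 1, c, σ =>
    if c.1 ∈ M.acc ∪ M.rej then (if c.1 ∈ M.acc ∧ σ = [] then 1 else 0)
    else ∑ p : S × SignType, M.δ c.1 (tapeSymbol w c.2) p *
      if movedHead c.2 p.2 ∈ I then sideWeight M w I e t (p.1, movedHead c.2 p.2) σ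
      else match σ with
        | [] => 0
        | [s] => if s = p.1 then 1 else 0
        | s :: s' :: σ' => if s = p.1 then sideWeight M w I e t (s', e) σ' else 0

/-- The weight of the part of a computation that takes place in `I`, if it starts outside of `I`. -/
noncomputable def reentryWeight (M : TwoPFA α S) (w : List α) (I : Set ℕ) (e : ℕ) (t : ℕ) :
    List S → ℝ≥0∞
  | [] => 1
  | s :: σ => sideWeight M w I e t (s, e) σ

-- After an exit, what remains of `σ` begins with a re-entry, so `reentryWeight` takes over. In this
-- form the two sides of a cut can alternate in an induction.
open Classical in
lemma sideWeight_succ (M : TwoPFA α S) (w : List α) (I : Set ℕ) (e t : ℕ) (c : S × ℕ)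
    (σ : List S) :
    M.sideWeight w I e (t + 1) c σ =
    if c.1 ∈ M.acc ∪ M.rej then (if c.1 ∈ M.acc ∧ σ = [] then (1 : ℝ≥0∞) else 0)
    else ∑ p : S × SignType, M.δ c.1 (tapeSymbol w c.2) p *
      if movedHead c.2 p.2 ∈ I then sideWeight M w I e t (p.1, movedHead c.2 p.2) σ
      else match σ with
        | [] => 0
        | s :: σ' => if s = p.1 then M.reentryWeight w I e t σ' else 0 := by
  rw [sideWeight]
  rcases σ with _ | ⟨s, _ | ⟨s', σ'⟩⟩ <;> rfl

lemma sum_delta (M : TwoPFA α S) (s : S) (a : TapeSymbol α) :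
    ∑ p : S × SignType, M.δ s a p = 1 := by
  rw [← tsum_fintype (L := .unconditional _)]
  exact (M.δ s a).tsum_coe

lemma sum_delta_mul_le (M : TwoPFA α S) (s : S) (a : TapeSymbol α) (f : S × SignType → ℝ≥0∞)
    (hf : ∀ p, f p ≤ 1) : ∑ p : S × SignType, M.δ s a p * f p ≤ 1 := by
  rw [← M.sum_delta s a]
  exact Finset.sum_le_sum fun p _ => mul_le_of_le_one_right' (hf p)

lemma sideWeight_le_one (M : TwoPFA α S) (w : List α) (I : Set ℕ) (e t : ℕ) :
    ∀ (c : S × ℕ) (σ : List S), M.sideWeight w I e t c σ ≤ 1 := by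
  induction t with
  | zero => intro c σ; rw [sideWeight]; split_ifs <;> simp
  | succ t ih =>
    intro c σ
    rw [sideWeight_succ]
    split_ifs with h1 h2
    · simp
    · simp
    · refine M.sum_delta_mul_le _ _ _ fun p => ?_
      split_ifs
      · exact ih _ _
      · rcases σ with _ | ⟨s, _ | ⟨s', σ'⟩⟩
        · simp
        · dsimp only; split_ifs <;> simp [reentryWeight]
        · dsimp only; split_ifs
          · exact ih _ _
          · simp

lemma reentryWeight_le_one (M : TwoPFA α S) (w : List α) (I : Set ℕ) (e t : ℕ) (σ : List S) :
    M.reentryWeight w I e t σ ≤ 1 := by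
  cases σ with
  | nil => exact le_rfl
  | cons s σ => exact M.sideWeight_le_one w I e t _ _

lemma sideWeight_le_succ (M : TwoPFA α S) (w : List α) (I : Set ℕ) (e t : ℕ) :
    ∀ (c : S × ℕ) (σ : List S),
      M.sideWeight w I e t c σ ≤ M.sideWeight w I e (t + 1) c σ := by
  induction t with
  | zero =>
    intro c σ
    rw [sideWeight_succ, sideWeight]
    by_cases h : c.1 ∈ M.acc
    · simp [h]
    · simp [h]
  | succ t ih =>
    intro c σ
    rw [sideWeight_succ, sideWeight_succ]
    split_ifs with h1 h2
    · exact le_rfl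
    · exact le_rfl
    · refine Finset.sum_le_sum fun p _ => ?_
      gcongr
      split_ifs
      · exact ih _ _
      · rcases σ with _ | ⟨s, _ | ⟨s', σ'⟩⟩
        · simp
        · simp [reentryWeight]
        · dsimp only; split_ifs
          · exact ih _ _
          · simp

lemma reentryWeight_le_succ (M : TwoPFA α S) (w : List α) (I : Set ℕ) (e t : ℕ) (σ : List S) :
    M.reentryWeight w I e t σ ≤ M.reentryWeight w I e (t + 1) σ := by
  cases σ with
  | nil => exact le_rfl
  | cons s σ => exact M.sideWeight_le_succ w I e t _ _

-- A move crosses the border of a set exactly when it crosses the border of the complement. This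
-- permits exchanging the two sides of a cut.
open Classical in
lemma crossExp_of_iff (M : TwoPFA α S) (w : List α) {I J : Set ℕ} (h : ∀ i, i ∈ J ↔ i ∉ I)
    (t : ℕ) : ∀ (c : S × ℕ) (g : List S → ℝ≥0∞),
      M.crossExp w J t c g = M.crossExp w I t c g := by
  induction t with
  | zero => intro c g; rfl
  | succ t ih =>
    intro c g
    have h' (i j : ℕ) : (i ∈ J ↔ j ∈ J) ↔ (i ∈ I ↔ j ∈ I) := by rw [h, h, not_iff_not]
    simp only [crossExp, ih]
    split_ifs
    · rfl
    · rfl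
    · refine Finset.sum_congr rfl fun p _ => ?_
      congr 2
      exact if_congr (h' _ _) rfl rfl

lemma crossExp_mono (M : TwoPFA α S) (w : List α) (I : Set ℕ) (t : ℕ) :
    ∀ (c : S × ℕ) {g g' : List S → ℝ≥0∞}, (∀ σ, g σ ≤ g' σ) →
      M.crossExp w I t c g ≤ M.crossExp w I t c g' := by
  induction t with
  | zero => intro c g g' h; simp only [crossExp]; split_ifs; exacts [h _, le_rfl]
  | succ t ih =>
    intro c g g' h
    simp only [crossExp]
    split_ifs
    · exact h _
    · exact le_rfl
    · refine Finset.sum_le_sum fun p _ => ?_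
      gcongr
      refine ih _ fun σ => ?_
      split_ifs <;> exact h _

lemma crossExp_add (M : TwoPFA α S) (w : List α) (I : Set ℕ) (t : ℕ) :
    ∀ (c : S × ℕ) (g g' : List S → ℝ≥0∞), M.crossExp w I t c (fun σ => g σ + g' σ) =
      M.crossExp w I t c g + M.crossExp w I t c g' := by
  induction t with
  | zero => intro c g g'; simp only [crossExp]; split_ifs <;> simp
  | succ t ih =>
    intro c g g'
    simp only [crossExp]
    split_ifs
    · rfl
    · simp
    · rw [← Finset.sum_add_distrib]
      refine Finset.sum_congr rfl fun p _ => ?_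
      rw [← mul_add, ← ih]
      congr 2
      split_ifs <;> rfl

lemma crossExp_zero (M : TwoPFA α S) (w : List α) (I : Set ℕ) (t : ℕ) :
    ∀ c : S × ℕ, M.crossExp w I t c (fun _ => 0) = 0 := by
  induction t with
  | zero => intro c; simp [crossExp]
  | succ t ih => intro c; simp [crossExp, ih]

lemma crossExp_const_mul (M : TwoPFA α S) (w : List α) (I : Set ℕ) (a : ℝ≥0∞) (t : ℕ) :
    ∀ (c : S × ℕ) (g : List S → ℝ≥0∞), M.crossExp w I t c (fun σ => a * g σ) =
      a * M.crossExp w I t c g := by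
  induction t with
  | zero => intro c g; simp only [crossExp]; split_ifs <;> simp
  | succ t ih =>
    intro c g
    simp only [crossExp]
    split_ifs
    · rfl
    · simp
    · rw [Finset.mul_sum]
      refine Finset.sum_congr rfl fun p _ => ?_
      rw [mul_left_comm, ← ih]
      congr 2
      split_ifs <;> rfl

lemma crossExp_sum (M : TwoPFA α S) (w : List α) (I : Set ℕ) (t : ℕ) (c : S × ℕ) {ι : Type*}
    (K : Finset ι) (g : ι → List S → ℝ≥0∞) :
    M.crossExp w I t c (fun σ => ∑ k ∈ K, g k σ) = ∑ k ∈ K, M.crossExp w I t c (g k) := by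
  classical
  induction K using Finset.induction_on with
  | empty => simpa using M.crossExp_zero w I t c
  | insert k K hk ih => simp only [Finset.sum_insert hk, crossExp_add, ih]

lemma crossExp_le_succ (M : TwoPFA α S) (w : List α) (I : Set ℕ) (t : ℕ) :
    ∀ (c : S × ℕ) (g : List S → ℝ≥0∞),
      M.crossExp w I t c g ≤ M.crossExp w I (t + 1) c g := by
  induction t with
  | zero =>
    intro c g
    simp only [crossExp, Set.mem_union]
    by_cases h : c.1 ∈ M.acc <;> simp [h]
  | succ t ih =>
    intro c g
    rw [crossExp, crossExp]
    split_ifs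
    · exact le_rfl
    · exact le_rfl
    · refine Finset.sum_le_sum fun p _ => ?_
      gcongr
      exact ih _ _

/-- `I` and `J` are complementary sets of positions, a head that moves from one to the other arrives
at the position `e` of `I` or at the position `e'` of `J`, and the tape of `w` agrees with the tape
of `u` in `I` and with the tape of `v` in `J`. -/
structure Cut (w u v : List α) (I J : Set ℕ) (e e' : ℕ) : Prop where
  mem_right_iff : ∀ i, i ∈ J ↔ i ∉ I
  left_symbol : ∀ i ∈ I, tapeSymbol w i = tapeSymbol u i
  right_symbol : ∀ i ∈ J, tapeSymbol w i = tapeSymbol v i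
  left_entry : ∀ i ∈ J, ∀ d, movedHead i d ∈ I → movedHead i d = e
  right_entry : ∀ i ∈ I, ∀ d, movedHead i d ∈ J → movedHead i d = e'

lemma Cut.symm {w u v : List α} {I J : Set ℕ} {e e' : ℕ} (h : Cut w u v I J e e') :
    Cut w v u J I e' e where
  mem_right_iff i := by rw [h.mem_right_iff, not_not]
  left_symbol := h.right_symbol
  right_symbol := h.left_symbol
  left_entry := h.right_entry
  right_entry := h.left_entry

-- A computation splits into its steps in `I` and its steps in `J`. Neither part has more than `t`
-- steps, so granting each side the full clock `t` only enlarges the product. At a crossing the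
-- induction hypothesis is used with the sides exchanged.
open Classical in
lemma crossExp_le_mul (M : TwoPFA α S) (t : ℕ) :
    ∀ {w u v : List α} {I J : Set ℕ} {e e' : ℕ}, Cut w u v I J e e' →
      ∀ (c : S × ℕ) (τ : List S), c.2 ∈ I →
      M.crossExp w I t c (fun σ => if σ = τ then 1 else 0) ≤
        M.sideWeight u I e t c τ * M.reentryWeight v J e' t τ := by
  induction t with
  | zero =>
    intro w u v I J e e' h c τ hc
    rw [crossExp, sideWeight]
    by_cases h1 : c.1 ∈ M.acc <;> by_cases h2 : τ = []
    · subst h2; simp [h1, reentryWeight]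
    · simp [h1, h2, Ne.symm h2]
    · simp [h1]
    · simp [h1]
  | succ t ih =>
    intro w u v I J e e' h c τ hc
    rw [crossExp, sideWeight_succ]
    by_cases h0 : c.1 ∈ M.acc ∪ M.rej
    · rw [if_pos h0, if_pos h0]
      by_cases h1 : c.1 ∈ M.acc <;> by_cases h2 : τ = []
      · subst h2; simp [h1, reentryWeight]
      · simp [h1, h2, Ne.symm h2]
      · simp [h1]
      · simp [h1]
    · rw [if_neg h0, if_neg h0]
      rw [Finset.sum_mul]
      refine Finset.sum_le_sum fun p _ => ?_
      rw [mul_assoc, h.left_symbol _ hc]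
      gcongr
      by_cases hp : movedHead c.2 p.2 ∈ I
      · rw [if_pos (iff_of_true hc hp), if_pos hp]
        exact (ih h _ _ hp).trans (by gcongr; exact M.reentryWeight_le_succ _ _ _ _ _)
      · rw [if_neg hp, if_neg (fun h' : _ ↔ _ => hp (h'.1 hc))]
        rcases τ with _ | ⟨s, τ⟩
        · simp [crossExp_zero]
        · by_cases hs : s = p.1
          · have hJ := (h.mem_right_iff _).2 hp
            have := ih h.symm (p.1, movedHead c.2 p.2) τ hJ
            rw [M.crossExp_of_iff _ h.mem_right_iff] at this
            simp only [hs, List.cons.injEq, true_and, if_true]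
            refine this.trans ?_
            rw [mul_comm, h.right_entry _ hc _ hJ]
            gcongr
            exact M.sideWeight_le_succ _ _ _ _ _ _
          · simp [hs, Ne.symm hs, crossExp_zero]

-- Two parts with the same `τ` interleave in exactly one way, and their clocks add up, whence `t +
-- r`. Since `u` and `v` may differ, weights taken from two words combine to computations on a third
-- one.
open Classical in
lemma mul_le_crossExp (M : TwoPFA α S) (N : ℕ) :
    ∀ {t r : ℕ}, t + r = N → ∀ {w u v : List α} {I J : Set ℕ} {e e' : ℕ}, Cut w u v I J e e' →
      ∀ (c : S × ℕ) (τ : List S), c.2 ∈ I →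
      M.sideWeight u I e t c τ * M.reentryWeight v J e' r τ ≤
        M.crossExp w I N c (fun σ => if σ = τ then 1 else 0) := by
  have halt (N : ℕ) (c : S × ℕ) (w : List α) (I : Set ℕ) (h : c.1 ∈ M.acc) :
      M.crossExp w I N c (fun σ => if σ = [] then 1 else 0) = 1 := by
    cases N <;> simp [crossExp, h]
  induction N with
  | zero =>
    intro t r htr w u v I J e e' h c τ hc
    obtain rfl : t = 0 := by omega
    rw [sideWeight]
    split_ifs with h1
    · rw [h1.2, halt _ _ _ _ h1.1]; simp [reentryWeight]
    · simp
  | succ N ih =>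
    intro t r htr w u v I J e e' h c τ hc
    rcases t with _ | t
    · rw [sideWeight]
      split_ifs with h1
      · rw [h1.2, halt _ _ _ _ h1.1]; simp [reentryWeight]
      · simp
    · rw [sideWeight_succ]
      split_ifs with h0 h1
      · rw [h1.2, halt _ _ _ _ h1.1]; simp [reentryWeight]
      · simp
      · rw [crossExp, if_neg h0, Finset.sum_mul]
        refine Finset.sum_le_sum fun p _ => ?_
        rw [mul_assoc, h.left_symbol _ hc]
        gcongr
        by_cases hp : movedHead c.2 p.2 ∈ I
        · rw [if_pos (iff_of_true hc hp), if_pos hp]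
          exact ih (by omega) h _ _ hp
        · rw [if_neg hp, if_neg (fun h' : _ ↔ _ => hp (h'.1 hc))]
          rcases τ with _ | ⟨s, τ⟩
          · simp
          · by_cases hs : s = p.1
            · have hJ := (h.mem_right_iff _).2 hp
              have := ih (t := r) (r := t) (by omega) h.symm (p.1, movedHead c.2 p.2) τ hJ
              rw [M.crossExp_of_iff _ h.mem_right_iff] at this
              simp only [hs, List.cons.injEq, true_and, if_true]
              refine le_trans ?_ this
              rw [mul_comm, h.right_entry _ hc _ hJ]
              exact le_rfl
            · simp [hs]

end TwoPFA

/-! ### Crossing expectations and the acceptance probability. -/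

namespace PMF

lemma tsum_bind_mul {β γ : Type*} (p : PMF β) (q : β → PMF γ) (f : γ → ℝ≥0∞) :
    ∑' b, (p.bind q) b * f b = ∑' a, p a * ∑' b, q a b * f b := by
  simp only [PMF.bind_apply, ← ENNReal.tsum_mul_right, ← ENNReal.tsum_mul_left]
  rw [ENNReal.tsum_comm]
  simp only [mul_assoc]

lemma tsum_pure_mul {β : Type*} (a : β) (f : β → ℝ≥0∞) :
    ∑' b, (PMF.pure a) b * f b = f a := by
  rw [tsum_eq_single a]
  · simp
  · intro b hb; simp [hb]

lemma tsum_map_mul {β γ : Type*} (p : PMF β) (h : β → γ) (f : γ → ℝ≥0∞) :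
    ∑' b, (p.map h) b * f b = ∑' a, p a * f (h a) := by
  rw [← PMF.bind_pure_comp, tsum_bind_mul]
  simp only [Function.comp, tsum_pure_mul]

end PMF

namespace TwoPFA

lemma acceptProbWithin_le_one {α S : Type} (M : TwoPFA α S) (w : List α) (t : ℕ) :
    M.acceptProbWithin w t ≤ 1 := by
  rw [acceptProbWithin, PMF.toOuterMeasure_apply, ← (M.law w t).tsum_coe]
  exact ENNReal.tsum_le_tsum fun c => Set.indicator_le_self _ _ _

variable {α S : Type} [Fintype S]

open Classical in
lemma crossExp_of_halted (M : TwoPFA α S) (w : List α) (I : Set ℕ) (t : ℕ) {c : S × ℕ}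
    (h : c.1 ∈ M.acc ∪ M.rej) (g : List S → ℝ≥0∞) :
    M.crossExp w I t c g = if c.1 ∈ M.acc then g [] else 0 := by
  cases t
  · rfl
  · rw [crossExp, if_pos h]

lemma crossExp_succ_const (M : TwoPFA α S) (w : List α) (I : Set ℕ) (t : ℕ) (c : S × ℕ)
    (a : ℝ≥0∞) :
    M.crossExp w I (t + 1) c (fun _ => a) =
      ∑' c', M.step w c c' * M.crossExp w I t c' (fun _ => a) := by
  rw [step]
  split_ifs with h
  · rw [PMF.tsum_pure_mul, crossExp_of_halted _ _ _ _ h, crossExp_of_halted _ _ _ _ h]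
  · rw [PMF.tsum_map_mul, crossExp, if_neg h, tsum_fintype]
    simp only [ite_self]

-- `law` unfolds at the last step and `crossExp` at the first. Moving one step at a time from one to
-- the other reconciles the two recursions.
open Classical in
lemma tsum_law_mul_crossExp (M : TwoPFA α S) (w : List α) (I : Set ℕ) (r : ℕ) :
    ∀ t : ℕ, ∑' c, M.law w t c * M.crossExp w I r c (fun _ => 1) =
      M.acceptProbWithin w (t + r) := by
  induction r with
  | zero =>
    intro t
    simp only [acceptProbWithin, PMF.toOuterMeasure_apply, crossExp, add_zero]
    refine tsum_congr fun c => ?_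
    rw [Set.indicator_apply]
    simp
  | succ r ih =>
    intro t
    simp only [crossExp_succ_const]
    rw [← PMF.tsum_bind_mul, ← law, ih]
    congr 1
    omega

lemma crossExp_one (M : TwoPFA α S) (w : List α) (I : Set ℕ) (t : ℕ) :
    M.crossExp w I t (M.start, 0) (fun _ => 1) = M.acceptProbWithin w t := by
  have := M.tsum_law_mul_crossExp w I t 0
  rwa [law, PMF.tsum_pure_mul, zero_add] at this

lemma crossExp_const_congr (M : TwoPFA α S) (w : List α) (I J : Set ℕ) (t : ℕ) (a : ℝ≥0∞) :
    ∀ c : S × ℕ, M.crossExp w I t c (fun _ => a) = M.crossExp w J t c (fun _ => a) := by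
  induction t with
  | zero => intro c; rfl
  | succ t ih => intro c; simp only [crossExp_succ_const, ih]

lemma acceptProbWithin_mono (M : TwoPFA α S) (w : List α) : Monotone (M.acceptProbWithin w) := by
  refine monotone_nat_of_le_succ fun t => ?_
  rw [← M.crossExp_one w ∅, ← M.crossExp_one w ∅]
  exact M.crossExp_le_succ _ _ _ _ _

/-- The head moves by at most one position, so it passes at most one boundary. A stationary move
passes none, and the value of `k` is then arbitrary. -/
lemma crossing_unique (i : ℕ) (d : SignType) :
    ∃ k, ∀ b, ¬ (i ∈ Set.Iic b ↔ movedHead i d ∈ Set.Iic b) → b = k := by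
  cases d
  · exact ⟨0, fun b h => absurd Iff.rfl h⟩
  · exact ⟨i - 1, fun b h => by simp only [Set.mem_Iic, movedHead] at h; omega⟩
  · exact ⟨i, fun b h => by simp only [Set.mem_Iic, movedHead] at h; omega⟩

-- In an accepting computation the crossing sequences at all boundaries together are no longer than
-- the number of steps. The term with `r` records the part of the budget `T` that is already spent,
-- which makes the induction on `t` work.
open Classical in
lemma sum_crossExp_length_le (M : TwoPFA α S) (w : List α) (B : Finset ℕ) (T : ℕ)
    (hT : ∀ t c, M.Reaches w t c → c.1 ∈ M.acc → t ≤ T) (t : ℕ) :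
    ∀ (r : ℕ) (c : S × ℕ), M.Reaches w r c →
      ∑ b ∈ B, M.crossExp w (Set.Iic b) t c (fun σ => (σ.length : ℝ≥0∞)) +
        r * M.crossExp w ∅ t c (fun _ => 1) ≤ T * M.crossExp w ∅ t c (fun _ => 1) := by
  have halted (t r : ℕ) (c : S × ℕ) (hr : M.Reaches w r c) :
      ∑ b ∈ B, (if c.1 ∈ M.acc then ((([] : List S).length : ℕ) : ℝ≥0∞) else 0) +
        r * (if c.1 ∈ M.acc then (1 : ℝ≥0∞) else 0) ≤
        T * (if c.1 ∈ M.acc then (1 : ℝ≥0∞) else 0) := by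
    split_ifs with h
    · simpa using hT _ _ hr h
    · simp
  induction t with
  | zero => exact halted 0
  | succ t ih =>
    intro r c hr
    by_cases h : c.1 ∈ M.acc ∪ M.rej
    · simp only [crossExp_of_halted _ _ _ _ h]
      exact halted (t + 1) r c hr
    · simp only [crossExp, if_neg h, ite_self]
      rw [Finset.sum_comm, Finset.mul_sum, Finset.mul_sum, ← Finset.sum_add_distrib]
      refine Finset.sum_le_sum fun p _ => ?_
      rw [← Finset.mul_sum, mul_left_comm, mul_left_comm (T : ℝ≥0∞), ← mul_add]
      -- Impossible transitions are split off because `Reaches`, and with it the bound `T`, covers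
      -- only those of positive probability.
      by_cases hp : M.δ c.1 (tapeSymbol w c.2) p = 0
      · simp [hp]
      gcongr
      refine le_trans ?_ (ih (r + 1) (p.1, movedHead c.2 p.2) (Reaches.step hr h hp))
      obtain ⟨k, hk⟩ := crossing_unique c.2 p.2
      have key : ∀ b ∈ B, M.crossExp w (Set.Iic b) t (p.1, movedHead c.2 p.2)
          (if (c.2 ∈ Set.Iic b ↔ movedHead c.2 p.2 ∈ Set.Iic b)
            then fun σ => (σ.length : ℝ≥0∞) else fun σ => ((p.1 :: σ).length : ℝ≥0∞)) ≤
          M.crossExp w (Set.Iic b) t (p.1, movedHead c.2 p.2) (fun σ => (σ.length : ℝ≥0∞)) +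
          if b = k then M.crossExp w ∅ t (p.1, movedHead c.2 p.2) (fun _ => 1) else 0 := by
        intro b _
        split_ifs with h1 h2 h2
        · exact le_self_add
        · simp
        · rw [M.crossExp_const_congr w ∅ (Set.Iic b), ← crossExp_add]
          simp
        · exact absurd (hk b h1) h2
      refine (add_le_add_left (Finset.sum_le_sum key) _).trans ?_
      rw [Finset.sum_add_distrib, add_assoc]
      gcongr
      rw [Nat.cast_add, Nat.cast_one, add_mul, one_mul, add_comm]
      gcongr
      rw [Finset.sum_ite_eq']
      split_ifs <;> simp

/-! ### Truncation to short crossing sequences. -/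

open Classical in
/-- The lists of length at most `m` over a finite type. -/
noncomputable def shortLists (S : Type) [Fintype S] (m : ℕ) : Finset (List S) :=
  (List.finite_length_le S m).toFinset

lemma mem_shortLists {m : ℕ} {σ : List S} : σ ∈ shortLists S m ↔ σ.length ≤ m := by
  simp [shortLists]

lemma card_shortLists_le (m : ℕ) :
    (shortLists S m).card ≤ (Fintype.card S + 1) ^ m := by
  classical
  -- A short list is padded with `none` to length `m`; the padding symbol explains the base `card S
  -- + 1`.
  have h : (shortLists S m).card ≤ (Finset.univ : Finset (Fin m → Option S)).card := by
    refine Finset.card_le_card_of_injOn (fun σ i => σ[(i : ℕ)]?) (fun _ _ => Finset.mem_univ _) ?_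
    intro σ hσ τ hτ h
    simp only [Finset.mem_coe, mem_shortLists] at hσ hτ
    refine List.ext_getElem? fun i => ?_
    by_cases hi : i < m
    · exact congrFun h ⟨i, hi⟩
    · rw [List.getElem?_eq_none (by omega), List.getElem?_eq_none (by omega)]
  simpa using h

open Classical in
lemma crossExp_short_eq_sum (M : TwoPFA α S) (w : List α) (I : Set ℕ) (t : ℕ) (c : S × ℕ)
    (m : ℕ) : M.crossExp w I t c (fun σ => if σ.length ≤ m then 1 else 0) =
      ∑ τ ∈ shortLists S m, M.crossExp w I t c (fun σ => if σ = τ then 1 else 0) := by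
  rw [← crossExp_sum]
  congr 1
  ext σ
  rw [Finset.sum_ite_eq]
  simp only [mem_shortLists]

/-- If few crossings are expected, then `M` mostly accepts with few crossings. -/
lemma acceptProbWithin_le_short_add (M : TwoPFA α S) (w : List α) (I : Set ℕ) (t m : ℕ)
    (e η : ℝ≥0∞)
    (he : M.crossExp w I t (M.start, 0) (fun σ => (σ.length : ℝ≥0∞)) ≤ e)
    (hη : e ≤ η * (m + 1)) :
    M.acceptProbWithin w t ≤
      M.crossExp w I t (M.start, 0) (fun σ => if σ.length ≤ m then 1 else 0) + η := by
  -- Markov's inequality: a sequence longer than `m` has length at least `m + 1`.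
  have hlong : M.crossExp w I t (M.start, 0) (fun σ => if σ.length ≤ m then 0 else 1) ≤ η := by
    have h0 : ((m : ℝ≥0∞) + 1) ≠ 0 := by simp
    have h1 : ((m : ℝ≥0∞) + 1) ≠ ∞ := by simp
    rw [← ENNReal.mul_le_mul_iff_right h0 h1, ← crossExp_const_mul, mul_comm _ η]
    refine le_trans (M.crossExp_mono w I t _ fun σ => ?_) (he.trans hη)
    split_ifs with h
    · simp
    · rw [mul_one]; exact_mod_cast (not_le.1 h)
  rw [← M.crossExp_one w I t]
  refine le_trans ?_ (add_le_add_right hlong _)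
  rw [← crossExp_add]
  refine M.crossExp_mono w I t _ fun σ => ?_
  split_ifs <;> simp

end TwoPFA

/-! ### The words `x #ⁿ y` and cuts in their middle block. -/

/-- The word `x #ⁿ y`. -/
def eqWord {n : ℕ} (x y : Fin n → Bool) : List Letter :=
  (List.ofFn x).map Letter.bit ++ List.replicate n Letter.hash ++ (List.ofFn y).map Letter.bit

lemma mem_languageEQ_iff {n : ℕ} {w : List Letter} :
    w ∈ languageEQ n ↔ ∃ x : Fin n → Bool, w = eqWord x x := by
  constructor
  · rintro ⟨x, y, rfl, -, rfl, rfl⟩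
    exact ⟨x.get, by simp [eqWord]⟩
  · rintro ⟨x, rfl⟩
    exact ⟨_, _, List.length_ofFn, List.length_ofFn, rfl, rfl⟩

lemma eqWord_injective {n : ℕ} {x y x' y' : Fin n → Bool} (h : eqWord x y = eqWord x' y') :
    x = x' ∧ y = y' := by
  have hb : Function.Injective Letter.bit := fun a b h => by injection h
  obtain ⟨h1, h2⟩ := List.append_inj h (by simp)
  obtain ⟨h3, -⟩ := List.append_inj h1 (by simp)
  exact ⟨List.ofFn_injective (List.map_injective_iff.2 hb h3),
    List.ofFn_injective (List.map_injective_iff.2 hb h2)⟩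

lemma eqWord_mem_languageEQ_iff {n : ℕ} {x y : Fin n → Bool} :
    eqWord x y ∈ languageEQ n ↔ x = y := by
  rw [mem_languageEQ_iff]
  constructor
  · rintro ⟨z, hz⟩
    obtain ⟨rfl, rfl⟩ := eqWord_injective hz
    rfl
  · rintro rfl
    exact ⟨x, rfl⟩

lemma length_of_mem_languageEQ {n : ℕ} {w : List Letter} (h : w ∈ languageEQ n) :
    w.length = 3 * n := by
  obtain ⟨x, rfl⟩ := mem_languageEQ_iff.1 h
  simp [eqWord]; omega

lemma tapeSymbol_succ_congr {α : Type} {w w' : List α} {i : ℕ} (h : w[i]? = w'[i]?) :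
    tapeSymbol w (i + 1) = tapeSymbol w' (i + 1) := by
  simp only [tapeSymbol, h]

namespace TwoPFA

/-- Position `i + 1` carries the letter with index `i`. So the positions up to `b ≤ 2n` do not see
`y`, and those beyond `b ≥ n` do not see `x`. -/
lemma cut_eqWord {n b : ℕ} (h1 : n ≤ b) (h2 : b ≤ 2 * n) (x y : Fin n → Bool) :
    Cut (eqWord x y) (eqWord x x) (eqWord y y) (Set.Iic b) (Set.Ioi b) b (b + 1) where
  mem_right_iff i := by simp
  left_symbol i hi := by
    rcases i with _ | i
    · rfl
    · refine tapeSymbol_succ_congr ?_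
      have : i < ((List.ofFn x).map Letter.bit ++ List.replicate n Letter.hash).length := by
        simp only [Set.mem_Iic] at hi
        simp; omega
      rw [eqWord, eqWord, List.getElem?_append_left this, List.getElem?_append_left this]
  right_symbol i hi := by
    rcases i with _ | i
    · rfl
    · refine tapeSymbol_succ_congr ?_
      have (z : Fin n → Bool) : ((List.ofFn z).map Letter.bit).length ≤ i := by
        simp only [Set.mem_Ioi] at hi
        simp; omega
      rw [eqWord, eqWord, List.append_assoc, List.append_assoc, List.getElem?_append_right (this _),
        List.getElem?_append_right (this _)]
      simp
  left_entry i hi d hd := by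
    cases d <;> simp only [Set.mem_Ioi, Set.mem_Iic, movedHead] at * <;> omega
  right_entry i hi d hd := by
    cases d <;> simp only [Set.mem_Ioi, Set.mem_Iic, movedHead] at * <;> omega

variable {S : Type} [Fintype S]

open Classical in
/-- For some position `b` between the two halves, many words of the language are mostly accepted
with at most `m` crossings of `b`. -/
theorem exists_few_crossings (M : TwoPFA Letter S) {n T m : ℕ} {a η : ℝ≥0∞} (hn : 1 ≤ n)
    (hT : ∀ w ∈ languageEQ n, ∀ t c, M.Reaches w t c → c.1 ∈ M.acc → t ≤ T)
    (hacc : ∀ w ∈ languageEQ n, a + η < M.acceptProb w)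
    (hm : (T : ℝ≥0∞) ≤ n * (η * (m + 1))) :
    ∃ (X : Finset (Fin n → Bool)) (b t : ℕ), 2 ^ n ≤ n * X.card ∧ n ≤ b ∧ b ≤ 2 * n ∧
      ∀ x ∈ X, a < M.crossExp (eqWord x x) (Set.Iic b) t (M.start, 0)
        (fun σ => if σ.length ≤ m then 1 else 0) := by
  have hx (x : Fin n → Bool) : ∃ b t : ℕ, b ∈ Finset.Ico n (2 * n) ∧
      a < M.crossExp (eqWord x x) (Set.Iic b) t (M.start, 0)
        (fun σ => if σ.length ≤ m then 1 else 0) := by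
    have hmem : eqWord x x ∈ languageEQ n := eqWord_mem_languageEQ_iff.2 rfl
    obtain ⟨t, ht⟩ := lt_iSup_iff.1 (hacc _ hmem)
    have hsum := M.sum_crossExp_length_le (eqWord x x) (Finset.Ico n (2 * n)) T (hT _ hmem) t 0 _
      Reaches.start
    rw [crossExp_one, Nat.cast_zero, zero_mul, add_zero] at hsum
    have hsum' := (hsum.trans (mul_le_of_le_one_right' (M.acceptProbWithin_le_one _ _))).trans hm
    -- Averaging over the `n` boundaries; the choice still depends on `x`.
    obtain ⟨b, hb, hbe⟩ : ∃ b ∈ Finset.Ico n (2 * n),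
        M.crossExp (eqWord x x) (Set.Iic b) t (M.start, 0) (fun σ => (σ.length : ℝ≥0∞)) ≤
          η * (m + 1) := by
      by_contra! hcon
      refine absurd hsum' (not_le.2 ?_)
      have := ENNReal.sum_lt_sum_of_nonempty (Finset.nonempty_Ico.2 (by omega : n < 2 * n)) hcon
      rw [Finset.sum_const, Nat.card_Ico, show 2 * n - n = n by omega, nsmul_eq_mul] at this
      exact this
    refine ⟨b, t, hb, ?_⟩
    have := ht.trans_le (M.acceptProbWithin_le_short_add _ _ _ _ _ _ hbe le_rfl)
    exact lt_of_add_lt_add_right this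
  choose β τ hβ hτ using hx
  -- Pigeonhole: the most frequent boundary serves at least `2^n / n` words. The supremum of the
  -- finitely many horizons `τ x` then serves all of them.
  obtain ⟨b, hb, hmax⟩ := Finset.exists_max_image (Finset.Ico n (2 * n))
    (fun b => (Finset.univ.filter fun x => β x = b).card)
    (Finset.nonempty_Ico.2 (by omega : n < 2 * n))
  refine ⟨Finset.univ.filter fun x => β x = b, b, Finset.univ.sup τ, ?_,
    (Finset.mem_Ico.1 hb).1, (Finset.mem_Ico.1 hb).2.le, ?_⟩
  · have := Finset.card_le_mul_card_image_of_maps_to (s := Finset.univ) (fun x _ => hβ x) _ hmax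
    rw [Nat.card_Ico, show 2 * n - n = n by omega, mul_comm] at this
    simpa using this
  · intro x hx
    rw [← (Finset.mem_filter.1 hx).2]
    refine (hτ x).trans_le ?_
    exact monotone_nat_of_le_succ (fun k => M.crossExp_le_succ _ _ k _ _)
      (Finset.le_sup (Finset.mem_univ x))

open Classical in
/-- The acceptance probability with at most `m` crossings is a sum of products of a weight that
depends on `x` and a weight that depends on `y`. -/
theorem exists_crossing_weights (M : TwoPFA Letter S) {n T m : ℕ} {a η : ℝ≥0∞} (hn : 1 ≤ n)
    (hT : ∀ w ∈ languageEQ n, ∀ t c, M.Reaches w t c → c.1 ∈ M.acc → t ≤ T)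
    (hacc : ∀ w ∈ languageEQ n, a + η < M.acceptProb w)
    (hm : (T : ℝ≥0∞) ≤ n * (η * (m + 1))) :
    ∃ (X : Finset (Fin n → Bool)) (P Q : (Fin n → Bool) → List S → ℝ≥0∞),
      2 ^ n ≤ n * X.card ∧ (∀ x σ, P x σ ≤ 1) ∧ (∀ x σ, Q x σ ≤ 1) ∧
      (∀ x ∈ X, a < ∑ σ ∈ shortLists S m, P x σ * Q x σ) ∧
      ∀ x y, ∑ σ ∈ shortLists S m, P x σ * Q y σ ≤ M.acceptProb (eqWord x y) := by
  obtain ⟨X, b, t, hX, hb1, hb2, hpos⟩ := M.exists_few_crossings hn hT hacc hm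
  refine ⟨X, fun x σ => M.sideWeight (eqWord x x) (Set.Iic b) b t (M.start, 0) σ,
    fun y σ => M.reentryWeight (eqWord y y) (Set.Ioi b) (b + 1) t σ, hX,
    fun x σ => M.sideWeight_le_one _ _ _ _ _ _, fun x σ => M.reentryWeight_le_one _ _ _ _ _,
    fun x hx => (hpos x hx).trans_le ?_, fun x y => ?_⟩
  · rw [crossExp_short_eq_sum]
    exact Finset.sum_le_sum fun σ _ =>
      M.crossExp_le_mul t (cut_eqWord hb1 hb2 x x) _ _ (Nat.zero_le b)
  -- The horizon doubles because each side has its own clock `t`. This is harmless, as `acceptProb`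
  -- is a supremum over all horizons.
  · refine (Finset.sum_le_sum fun σ _ =>
      M.mul_le_crossExp (t + t) rfl (cut_eqWord hb1 hb2 x y) (M.start, 0) σ (Nat.zero_le b)).trans ?_
    rw [← crossExp_short_eq_sum]
    refine le_trans ?_ (le_iSup _ (t + t))
    rw [← M.crossExp_one _ (Set.Iic b)]
    refine M.crossExp_mono _ _ _ _ fun σ => ?_
    split_ifs <;> simp

end TwoPFA

/-! ### Counting: the pigeonhole factor and approximate identity matrices. -/

lemma pow_three_le_four_pow (n : ℕ) : n ^ 3 ≤ 4 ^ n := by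
  rcases n with _ | _ | _ | n
  · norm_num
  · norm_num
  · norm_num
  · induction n with
    | zero => norm_num
    | succ n ih =>
      have : (n + 4) ^ 3 ≤ 4 * (n + 3) ^ 3 := by
        nlinarith [Nat.zero_le (n ^ 3), Nat.zero_le (n ^ 2)]
      calc (n + 4) ^ 3 ≤ 4 * (n + 3) ^ 3 := this
        _ ≤ 4 * 4 ^ (n + 3) := Nat.mul_le_mul_left _ ih
        _ = 4 ^ (n + 4) := by ring

/-- Cubing gives room to absorb the factor `n`: `8^n = 4^n * 2^n` and `n^3 ≤ 4^n`. -/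
lemma two_pow_le_pow_three {n N : ℕ} (h : 2 ^ n ≤ n * N) : 2 ^ n ≤ N ^ 3 := by
  have h1 : (2 ^ n) ^ 3 ≤ n ^ 3 * N ^ 3 := by rw [← mul_pow]; exact Nat.pow_le_pow_left h 3
  have h2 : (2 ^ n) ^ 3 = 4 ^ n * 2 ^ n := by
    rw [show 4 = 2 ^ 2 by norm_num, ← pow_mul, ← pow_mul, ← pow_add]; congr 1; ring
  have h3 : 4 ^ n * 2 ^ n ≤ 4 ^ n * N ^ 3 := by
    rw [← h2]
    exact h1.trans (Nat.mul_le_mul_right _ (pow_three_le_four_pow n))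
  exact Nat.le_of_mul_le_mul_left h3 (by positivity)

lemma succ_pow_le_pow_two_mul {s : ℕ} (hs : 2 ≤ s) (m : ℕ) : (s + 1) ^ m ≤ s ^ (2 * m) := by
  rw [pow_mul]
  exact Nat.pow_le_pow_left (by nlinarith) m

/-- If the sums `∑ σ ∈ K, P x σ * Q y σ` approximate the identity matrix with the index set `X`,
then `X` is small. -/
lemma card_le_pow_of_approx_identity {V ι : Type*} (X : Finset V) (K : Finset ι)
    (P Q : V → ι → ℝ≥0∞) (hP : ∀ x σ, P x σ ≤ 1) (hQ : ∀ x σ, Q x σ ≤ 1) {ε : ℝ≥0∞} {δ : ℝ}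
    {D : ℕ} (hD : 0 < D) (hKD : (K.card : ℝ) ≤ δ * D)
    (hdiag : ∀ x ∈ X, ε + ENNReal.ofReal δ < ∑ σ ∈ K, P x σ * Q x σ)
    (hoff : ∀ x ∈ X, ∀ y ∈ X, x ≠ y → ∑ σ ∈ K, P x σ * Q y σ ≤ ε) :
    X.card ≤ (D + 1) ^ K.card := by
  classical
  have hD' : (0 : ℝ) < D := by exact_mod_cast hD
  have hle (x : V) (σ : ι) : (P x σ).toReal ≤ 1 := by
    simpa using ENNReal.toReal_mono ENNReal.one_ne_top (hP x σ)
  -- Each row is rounded down to the grid of mesh `1 / D`. If `X` is too large, two rows agree after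
  -- rounding.
  let r (x : V) (σ : K) : Fin (D + 1) := ⟨⌊D * (P x σ).toReal⌋₊, by
    rw [Nat.lt_succ_iff]
    refine Nat.floor_le_of_le ?_
    have := hle x σ
    nlinarith⟩
  by_contra! hcon
  obtain ⟨x, hx, y, hy, hxy, hr⟩ := Finset.exists_ne_map_eq_of_card_lt_of_maps_to (s := X)
    (t := (Finset.univ : Finset (K → Fin (D + 1)))) (f := r) (by simpa using hcon)
    (fun _ _ => Finset.mem_coe.2 (Finset.mem_univ _))
  refine absurd (hdiag y hy) (not_lt.2 ?_)
  have hPxy (σ : ι) (hσ : σ ∈ K) : P y σ ≤ P x σ + ENNReal.ofReal (1 / D) := by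
    have h1 : ⌊D * (P x σ).toReal⌋₊ = ⌊D * (P y σ).toReal⌋₊ :=
      congrArg Fin.val (congrFun hr ⟨σ, hσ⟩)
    have h2 := Nat.lt_floor_add_one (D * (P y σ).toReal)
    have h3 : (⌊D * (P x σ).toReal⌋₊ : ℝ) ≤ D * (P x σ).toReal := Nat.floor_le (by positivity)
    rw [h1] at h3
    have h4 : (P y σ).toReal ≤ (P x σ).toReal + 1 / D := by
      rw [← mul_le_mul_iff_right₀ hD', mul_add, mul_one_div_cancel hD'.ne']
      linarith
    have hne (z : V) : P z σ ≠ ∞ := ((hP z σ).trans_lt ENNReal.one_lt_top).ne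
    rw [← ENNReal.ofReal_toReal (hne x), ← ENNReal.ofReal_toReal (hne y),
      ← ENNReal.ofReal_add ENNReal.toReal_nonneg (by positivity)]
    exact ENNReal.ofReal_le_ofReal h4
  -- Replacing the row of `y` by that of `x` costs at most `1 / D` per `σ`, in total at most `δ`,
  -- and turns a diagonal entry into an off-diagonal one.
  calc ∑ σ ∈ K, P y σ * Q y σ
      ≤ ∑ σ ∈ K, (P x σ * Q y σ + ENNReal.ofReal (1 / D)) := by
        refine Finset.sum_le_sum fun σ hσ => ?_
        refine (mul_le_mul_left (hPxy σ hσ) _).trans ?_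
        rw [add_mul]
        gcongr
        exact mul_le_of_le_one_right' (hQ y σ)
    _ ≤ ε + ENNReal.ofReal δ := by
        rw [Finset.sum_add_distrib]
        refine add_le_add (hoff x hx y hy hxy) ?_
        rw [Finset.sum_const, nsmul_eq_mul, ← ENNReal.ofReal_natCast,
          ← ENNReal.ofReal_mul (by positivity)]
        refine ENNReal.ofReal_le_ofReal ?_
        rw [mul_one_div, div_le_iff₀ hD']
        exact hKD

/-! ### Lower bounds for probabilistic automata. -/

namespace TwoPFA

variable {α S : Type}

/-- `law` stays at a halting configuration whereas `Reaches` stops there, so `r` may be smaller than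
`t`. -/
lemma exists_reaches_of_law_ne_zero (M : TwoPFA α S) (w : List α) (t : ℕ) :
    ∀ c, M.law w t c ≠ 0 → ∃ r, M.Reaches w r c := by
  induction t with
  | zero =>
    intro c hc
    rw [law, ← PMF.mem_support_iff, PMF.support_pure, Set.mem_singleton_iff] at hc
    subst hc
    exact ⟨0, Reaches.start⟩
  | succ t ih =>
    intro c hc
    rw [law, ← PMF.mem_support_iff, PMF.mem_support_bind_iff] at hc
    obtain ⟨c', hc', hc⟩ := hc
    obtain ⟨r, hr⟩ := ih c' hc'
    rw [step] at hc
    split_ifs at hc with h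
    · rw [PMF.support_pure, Set.mem_singleton_iff] at hc
      subst hc
      exact ⟨r, hr⟩
    · rw [PMF.mem_support_map_iff] at hc
      obtain ⟨p, hp, rfl⟩ := hc
      exact ⟨r + 1, Reaches.step hr h hp⟩

lemma exists_reaches_of_acceptProb_ne_zero (M : TwoPFA α S) {w : List α}
    (h : M.acceptProb w ≠ 0) : ∃ t c, M.Reaches w t c ∧ c.1 ∈ M.acc := by
  obtain ⟨t, ht⟩ : ∃ t, M.acceptProbWithin w t ≠ 0 := by
    by_contra! hcon
    exact h (by simp [acceptProb, hcon])
  rw [acceptProbWithin, Ne, PMF.toOuterMeasure_apply_eq_zero_iff, Set.not_disjoint_iff] at ht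
  obtain ⟨c, hc, hacc⟩ := ht
  obtain ⟨r, hr⟩ := M.exists_reaches_of_law_ne_zero w t c hc
  exact ⟨r, c, hr, hacc⟩

lemma one_le_acceptProb_of_start_mem (M : TwoPFA α S) (h : M.start ∈ M.acc) (w : List α) :
    1 ≤ M.acceptProb w := by
  refine le_trans (le_of_eq ?_) (le_iSup _ 0)
  rw [acceptProbWithin, law, PMF.toOuterMeasure_pure_apply, if_pos]
  exact h

lemma le_time (M : TwoPFA α S) {L : Language α} {w : List α} (hw : w ∈ L) {t : ℕ} {c : S × ℕ}
    (hr : M.Reaches w t c) (hc : c.1 ∈ M.acc) : (t : ℕ∞) ≤ M.time L :=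
  le_iSup₂_of_le w hw (le_iSup₂_of_le t ⟨c, hr, hc⟩ le_rfl)

/-- An automaton with positive acceptance probabilities on a nonempty language that does not accept
all words has at least two states and takes at least one step. -/
lemma two_le_card_and_one_le_time [Fintype S] (M : TwoPFA α S) {L : Language α} {w v : List α}
    (hw : w ∈ L) (hacc : M.acceptProb w ≠ 0) (hv : M.acceptProb v < 1) :
    2 ≤ Fintype.card S ∧ 1 ≤ M.time L := by
  obtain ⟨t, c, hr, hc⟩ := M.exists_reaches_of_acceptProb_ne_zero hacc
  have hstart : M.start ∉ M.acc := fun h => absurd hv (not_lt.2 (M.one_le_acceptProb_of_start_mem h v))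
  constructor
  · refine Fintype.one_lt_card_iff.2 ⟨c.1, M.start, fun h => hstart (h ▸ hc)⟩
  · refine le_trans ?_ (M.le_time hw hr hc)
    rcases t with _ | t
    · cases hr
      exact absurd hc hstart
    · exact_mod_cast Nat.succ_le_succ (Nat.zero_le t)

/-- A lower bound on time times space may be proved under the assumption that the time is finite. -/
lemma ofReal_le_timeSpace [Fintype S] (M : TwoPFA α S) {L : Language α} {a : ℝ}
    (hS : 2 ≤ Fintype.card S)
    (h : ∀ T : ℕ, M.time L = T → a ≤ T * Real.logb 2 (Fintype.card S)) :
    ENNReal.ofReal a ≤ M.timeSpace L := by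
  have hS' : (1 : ℝ) < Fintype.card S := by exact_mod_cast hS
  rw [timeSpace]
  rcases hT : M.time L with _ | T
  -- With a single state the product would be `∞ * 0 = 0`; this is why `hS` is needed here.
  · have : ENNReal.ofReal (Real.logb 2 (Fintype.card S)) ≠ 0 := by
      rw [Ne, ENNReal.ofReal_eq_zero, not_le]
      exact Real.logb_pos one_lt_two hS'
    change _ ≤ ((⊤ : ℕ∞) : ℝ≥0∞) * _
    rw [ENat.toENNReal_top, ENNReal.top_mul this]
    exact le_top
  · change _ ≤ ((T : ℕ∞) : ℝ≥0∞) * _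
    rw [ENat.toENNReal_coe, ← ENNReal.ofReal_natCast, ← ENNReal.ofReal_mul (by positivity)]
    exact ENNReal.ofReal_le_ofReal (h T hT)

variable [Fintype S]

/-- A fooling set argument: if the same `σ` has nonzero weight in the diagonal entries of `x` and of
`y`, then `P x σ * Q y σ` is nonzero and `x #ⁿ y` is accepted with positive probability. So choosing
such a `σ` for each `x` is injective. -/
lemma sq_le_time_mul_logb (M : TwoPFA Letter S) {n T : ℕ} (hn : 1 ≤ n)
    (hS : 2 ≤ Fintype.card S)
    (hT : ∀ w ∈ languageEQ n, ∀ t c, M.Reaches w t c → c.1 ∈ M.acc → t ≤ T)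
    (hacc : ∀ w ∈ languageEQ n, 1 / 2 < M.acceptProb w)
    (hrej : ∀ w ∉ languageEQ n, M.acceptProb w = 0) :
    (n : ℝ) ^ 2 ≤ 12 * (T * Real.logb 2 (Fintype.card S)) := by
  classical
  -- Half of the acceptance probability may be lost to long sequences, so `n * (m + 1)` has to reach
  -- `2 * T`.
  set m := 2 * T / n with hm
  have hm1 : 2 * T ≤ n * (m + 1) := (Nat.lt_mul_div_succ _ hn).le
  have hm2 : m * n ≤ 2 * T := Nat.div_mul_le_self _ _
  obtain ⟨X, P, Q, hX, -, -, hdiag, hoff⟩ := M.exists_crossing_weights (m := m) (a := 0)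
    (η := 1 / 2) hn hT (by simpa using hacc) (by
      have : (2 : ℝ≥0∞) * T ≤ n * (m + 1) := by exact_mod_cast hm1
      have h2 : (T : ℝ≥0∞) = 1 / 2 * (2 * T) := by
        rw [← mul_assoc, one_div, ENNReal.inv_mul_cancel (by simp) (by simp), one_mul]
      rw [h2, mul_left_comm (n : ℝ≥0∞)]
      exact mul_le_mul' le_rfl this)
  have hex (x : Fin n → Bool) (hx : x ∈ X) : ∃ σ ∈ shortLists S m, P x σ * Q x σ ≠ 0 := by
    by_contra! hcon
    exact (hdiag x hx).ne' (Finset.sum_eq_zero hcon)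
  choose! f hf hPQ using hex
  have hcard : X.card ≤ (shortLists S m).card := by
    refine Finset.card_le_card_of_injOn f hf fun x hx y hy hxy => ?_
    by_contra hne
    have h0 := hoff x y
    rw [hrej _ (mt eqWord_mem_languageEQ_iff.1 hne), nonpos_iff_eq_zero,
      Finset.sum_eq_zero_iff] at h0
    have h1 := h0 _ (hf x hx)
    rcases mul_eq_zero.1 h1 with h2 | h2
    · exact hPQ x hx (by rw [h2, zero_mul])
    · rw [hxy] at h2
      exact hPQ y hy (by rw [h2, mul_zero])
  have h1 : 2 ^ n ≤ n * Fintype.card S ^ (2 * m) := hX.trans (Nat.mul_le_mul_left _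
    (hcard.trans ((card_shortLists_le m).trans (succ_pow_le_pow_two_mul hS m))))
  have h2 := two_pow_le_pow_three h1
  rw [← pow_mul] at h2
  have hlog : (n : ℝ) ≤ (2 * m * 3 : ℕ) * Real.logb 2 (Fintype.card S) := by
    have h3 : (2 : ℝ) ^ n ≤ (Fintype.card S : ℝ) ^ (2 * m * 3) := by exact_mod_cast h2
    have h4 := Real.logb_le_logb_of_le one_lt_two (by positivity) h3
    rwa [Real.logb_pow, Real.logb_pow, Real.logb_self_eq_one one_lt_two, mul_one] at h4
  have hpos : 0 ≤ Real.logb 2 (Fintype.card S) :=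
    Real.logb_nonneg one_lt_two (by exact_mod_cast (by omega : 1 ≤ Fintype.card S))
  have hm3 : (m : ℝ) * n ≤ 2 * T := by exact_mod_cast hm2
  push_cast at hlog
  calc (n : ℝ) ^ 2 = n * n := sq _
    _ ≤ (2 * m * 3 * Real.logb 2 (Fintype.card S)) * n := by gcongr
    _ = 6 * Real.logb 2 (Fintype.card S) * (m * n) := by ring
    _ ≤ 6 * Real.logb 2 (Fintype.card S) * (2 * T) := by gcongr
    _ = _ := by ring

/-- Rounding bounds `2^n` by an expression exponential in `K²`, and `K` is itself at most `s^(2m)`.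
Taking the logarithm twice leaves `log n` in place of `n`. -/
lemma logb_le_time_mul_logb (M : TwoPFA Letter S) {n T : ℕ} {ε δ : ℝ} (hδ : 0 < δ)
    (hε : 0 ≤ ε) (hεδ : ε + 2 * δ < 1 - ε) (hn : 1 ≤ n) (hS : 2 ≤ Fintype.card S)
    (hT : ∀ w ∈ languageEQ n, ∀ t c, M.Reaches w t c → c.1 ∈ M.acc → t ≤ T)
    (hM : M.Recognizes ε (languageEQ n)) :
    δ * n * (Real.logb 2 n - Real.logb 2 (3 * (1 / δ + 1))) ≤
      4 * (T * Real.logb 2 (Fintype.card S)) := by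
  have hn0 : (0 : ℝ) < n := by exact_mod_cast hn
  set m := ⌊T / (δ * n)⌋₊ with hm
  have hm1 : (T : ℝ) ≤ n * (δ * (m + 1)) := by
    have := (Nat.lt_floor_add_one (T / (δ * n))).le
    rw [div_le_iff₀ (by positivity)] at this
    linarith
  have hm2 : m * (δ * n) ≤ T := by
    rw [← le_div_iff₀ (by positivity)]
    exact Nat.floor_le (by positivity)
  -- One `δ` pays for the long crossing sequences; the other remains as the gap that the rounding
  -- argument consumes.
  obtain ⟨X, P, Q, hX, hP, hQ, hdiag, hoff⟩ := M.exists_crossing_weights (m := m)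
    (a := ENNReal.ofReal ε + ENNReal.ofReal δ) (η := ENNReal.ofReal δ) hn hT (fun w hw => by
      refine lt_of_lt_of_le ?_ (hM.1 w hw)
      rw [← ENNReal.ofReal_add hε hδ.le, ← ENNReal.ofReal_add (by positivity) hδ.le,
        ENNReal.ofReal_lt_ofReal_iff (by linarith)]
      linarith) (by
      have := ENNReal.ofReal_le_ofReal hm1
      rwa [ENNReal.ofReal_natCast, ENNReal.ofReal_mul (by positivity),
        ENNReal.ofReal_mul hδ.le, ENNReal.ofReal_natCast,
        ENNReal.ofReal_add (by positivity) zero_le_one, ENNReal.ofReal_natCast,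
        ENNReal.ofReal_one] at this)
  set K := (shortLists S m).card with hK
  have hK1 : 1 ≤ K := Finset.card_pos.2 ⟨[], mem_shortLists.2 (Nat.zero_le _)⟩
  have hK1' : (1 : ℝ) ≤ K := by exact_mod_cast hK1
  set D := ⌈K / δ⌉₊ with hD
  have hD0 : 0 < D := Nat.ceil_pos.2 (by positivity)
  have hD1 : (K : ℝ) ≤ δ * D := by
    have := Nat.le_ceil (K / δ)
    rw [div_le_iff₀ hδ] at this
    linarith
  have hD2 : (D : ℝ) ≤ K * (1 / δ + 1) := by
    have := (Nat.ceil_lt_add_one (by positivity : 0 ≤ K / δ)).le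
    rw [mul_add, mul_one_div]
    linarith
  have hcard := card_le_pow_of_approx_identity X (shortLists S m) P Q hP hQ hD0 hD1 hdiag
    (fun x _ y _ hxy => (hoff x y).trans (hM.2 _ (mt eqWord_mem_languageEQ_iff.1 hxy)))
  have h1 := two_pow_le_pow_three (hX.trans (Nat.mul_le_mul_left _ hcard))
  have h2 : n ≤ D * K * 3 := by
    -- By `D + 1 ≤ 2^D` the bound becomes `2^n ≤ 2^(3DK)`.
    rw [← Nat.pow_le_pow_iff_right (le_refl 2), pow_mul, pow_mul]
    refine h1.trans (Nat.pow_le_pow_left (Nat.pow_le_pow_left ?_ _) _)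
    exact Nat.lt_two_pow_self
  have hKS : (K : ℝ) ≤ (Fintype.card S : ℝ) ^ (2 * m) := by
    exact_mod_cast (card_shortLists_le m).trans (succ_pow_le_pow_two_mul hS m)
  have h3 : (n : ℝ) ≤ 3 * (1 / δ + 1) * (Fintype.card S : ℝ) ^ (4 * m) := by
    calc (n : ℝ) ≤ D * K * 3 := by exact_mod_cast h2
      _ ≤ (K * (1 / δ + 1)) * K * 3 := by gcongr
      _ = 3 * (1 / δ + 1) * (K * K) := by ring
      _ ≤ 3 * (1 / δ + 1) * ((Fintype.card S : ℝ) ^ (2 * m) * (Fintype.card S : ℝ) ^ (2 * m)) := by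
        gcongr
      _ = _ := by rw [← pow_add]; congr 2; ring
  have hS0 : (0 : ℝ) < Fintype.card S := by exact_mod_cast (by omega : 0 < Fintype.card S)
  have h4 := Real.logb_le_logb_of_le one_lt_two hn0 h3
  rw [Real.logb_mul (by positivity) (by positivity), Real.logb_pow] at h4
  have hpos : 0 ≤ Real.logb 2 (Fintype.card S) :=
    Real.logb_nonneg one_lt_two (by exact_mod_cast (by omega : 1 ≤ Fintype.card S))
  push_cast at h4
  calc δ * n * (Real.logb 2 n - Real.logb 2 (3 * (1 / δ + 1)))
      ≤ δ * n * (4 * m * Real.logb 2 (Fintype.card S)) := by gcongr; linarith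
    _ = 4 * Real.logb 2 (Fintype.card S) * (m * (δ * n)) := by ring
    _ ≤ 4 * Real.logb 2 (Fintype.card S) * T := by gcongr
    _ = _ := by ring

end TwoPFA

lemma nil_notMem_languageEQ {n : ℕ} (hn : 1 ≤ n) : [] ∉ languageEQ n := fun h => by
  have := length_of_mem_languageEQ h
  simp at this
  omega

theorem exists_lower_bound_ts2PFA {ε : ℝ} (hε : 0 < ε) (hε' : ε < 1 / 2) :
    ∃ c : ℝ, 0 < c ∧ ∀ n : ℕ, 2 ≤ n →
      ENNReal.ofReal (c * ((n : ℝ) * Real.logb 2 n)) ≤ ts2PFA ε (languageEQ n) := by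
  obtain ⟨δ, hδ, hεδ⟩ : ∃ δ : ℝ, 0 < δ ∧ ε + 2 * δ < 1 - ε :=
    ⟨(1 - 2 * ε) / 4, by linarith, by linarith⟩
  set b := Real.logb 2 (3 * (1 / δ + 1)) with hb
  -- Beyond `n₀` the constant `b` is at most half of `log n`. Up to `n₀` one has `n log n ≤ n₀²`,
  -- and the trivial bound `1` on time times space suffices.
  set n₀ : ℝ := 2 ^ (2 * b) with hn₀
  have hn₀pos : 0 < n₀ := by positivity
  refine ⟨min (δ / 8) (1 / n₀ ^ 2), by positivity, fun n hn => ?_⟩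
  have hn0 : (2 : ℝ) ≤ n := by exact_mod_cast hn
  have hlogn : 0 ≤ Real.logb 2 n := Real.logb_nonneg one_lt_two (by linarith)
  refine le_iInf fun S => le_iInf fun _ => le_iInf fun M => le_iInf fun hM => ?_
  have hmem := eqWord_mem_languageEQ_iff.2 (rfl : (fun _ : Fin n => true) = fun _ => true)
  obtain ⟨hS, hT1⟩ := M.two_le_card_and_one_le_time (v := []) hmem
    ((ENNReal.ofReal_pos.2 (by linarith)).trans_le (hM.1 _ hmem)).ne'
    ((hM.2 _ (nil_notMem_languageEQ (by omega))).trans_lt (by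
      rw [ENNReal.ofReal_lt_one]; linarith))
  refine M.ofReal_le_timeSpace hS fun T hT => ?_
  have hlogS : 1 ≤ Real.logb 2 (Fintype.card S) := by
    rw [Real.le_logb_iff_rpow_le one_lt_two (by positivity), Real.rpow_one]
    exact_mod_cast hS
  have hT1' : (1 : ℝ) ≤ T := by rw [hT] at hT1; exact_mod_cast hT1
  have hmain := M.logb_le_time_mul_logb hδ hε.le hεδ (by omega) hS (fun w hw t c hr hc => by
    have := M.le_time hw hr hc
    rw [hT] at this
    exact_mod_cast this) hM
  rw [← hb] at hmain
  rcases le_total (2 * b) (Real.logb 2 n) with hbn | hbn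
  · calc min (δ / 8) (1 / n₀ ^ 2) * (n * Real.logb 2 n) ≤ δ / 8 * (n * Real.logb 2 n) := by
          gcongr; exact min_le_left _ _
      _ = (δ * n * (Real.logb 2 n / 2)) / 4 := by ring
      _ ≤ (δ * n * (Real.logb 2 n - b)) / 4 := by gcongr; linarith
      _ ≤ _ := by linarith
  · have hnn₀ : (n : ℝ) ≤ n₀ := (Real.logb_le_iff_le_rpow one_lt_two (by linarith)).1 hbn
    have hlog : Real.logb 2 n ≤ n := by
      rw [Real.logb_le_iff_le_rpow one_lt_two (by linarith), Real.rpow_natCast]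
      exact_mod_cast Nat.lt_two_pow_self.le
    calc min (δ / 8) (1 / n₀ ^ 2) * (n * Real.logb 2 n)
        ≤ 1 / n₀ ^ 2 * (n₀ * n₀) := by
          gcongr
          · exact min_le_right _ _
          · exact hlog.trans hnn₀
      _ = 1 := by field_simp
      _ ≤ T * Real.logb 2 (Fintype.card S) := one_le_mul_of_one_le_of_one_le hT1' hlogS

/-! ### Deterministic automata as probabilistic ones. -/

namespace TwoDFA

variable {α S : Type}

/-- A deterministic automaton as a probabilistic automaton. -/
noncomputable def toTwoPFA (M : TwoDFA α S) : TwoPFA α S where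
  δ s a := PMF.pure (M.δ s a)
  start := M.start
  acc := M.acc
  rej := M.rej
  disjoint_acc_rej := M.disjoint_acc_rej
  leftEnd_eq_zero s s' := by
    rw [PMF.pure_apply, if_neg]
    exact fun h => M.leftEnd_ne s (by rw [← h])
  rightEnd_eq_zero s s' := by
    rw [PMF.pure_apply, if_neg]
    exact fun h => M.rightEnd_ne s (by rw [← h])

lemma config_succ (M : TwoDFA α S) (w : List α) (t : ℕ) :
    M.config w (t + 1) = M.step w (M.config w t) :=
  Function.iterate_succ_apply' _ _ _

lemma law_toTwoPFA (M : TwoDFA α S) (w : List α) (t : ℕ) :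
    M.toTwoPFA.law w t = PMF.pure (M.config w t) := by
  induction t with
  | zero => rfl
  | succ t ih =>
    rw [TwoPFA.law, ih, PMF.pure_bind, config_succ, TwoPFA.step, step]
    by_cases h : (M.config w t).1 ∈ M.acc ∪ M.rej
    · rw [if_pos h]
      exact if_pos h
    · rw [if_neg h]
      refine (if_neg h).trans ?_
      rw [toTwoPFA, PMF.pure_map]

open Classical in
lemma acceptProbWithin_toTwoPFA (M : TwoDFA α S) (w : List α) (t : ℕ) :
    M.toTwoPFA.acceptProbWithin w t = if (M.config w t).1 ∈ M.acc then 1 else 0 := by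
  rw [TwoPFA.acceptProbWithin, law_toTwoPFA, PMF.toOuterMeasure_pure_apply]
  rfl

lemma config_of_halted (M : TwoDFA α S) (w : List α) {t : ℕ}
    (h : (M.config w t).1 ∈ M.acc ∪ M.rej) (r : ℕ) : M.config w (t + r) = M.config w t := by
  induction r with
  | zero => rfl
  | succ r ih => rw [← add_assoc, config_succ, ih, step, if_pos h]

lemma not_accepts_of_rejects (M : TwoDFA α S) {w : List α} (h : M.Rejects w) : ¬ M.Accepts w := by
  rintro ⟨t, ht⟩
  obtain ⟨r, hr⟩ := h
  have h1 : (M.config w (t + r)).1 ∈ M.acc := by rwa [M.config_of_halted w (Or.inl ht)]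
  have h2 : (M.config w (t + r)).1 ∈ M.rej := by rwa [add_comm, M.config_of_halted w (Or.inr hr)]
  exact Set.disjoint_left.1 M.disjoint_acc_rej h1 h2

lemma acceptProb_toTwoPFA_of_accepts (M : TwoDFA α S) {w : List α} (h : M.Accepts w) :
    1 ≤ M.toTwoPFA.acceptProb w := by
  obtain ⟨t, ht⟩ := h
  refine le_trans (le_of_eq ?_) (le_iSup _ t)
  rw [acceptProbWithin_toTwoPFA, if_pos ht]

lemma acceptProb_toTwoPFA_of_rejects (M : TwoDFA α S) {w : List α} (h : M.Rejects w) :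
    M.toTwoPFA.acceptProb w = 0 := by
  rw [TwoPFA.acceptProb, ENNReal.iSup_eq_zero]
  intro t
  rw [acceptProbWithin_toTwoPFA, if_neg fun ht => M.not_accepts_of_rejects h ⟨t, ht⟩]

lemma config_of_reaches (M : TwoDFA α S) {w : List α} {t : ℕ} {c : S × ℕ}
    (h : M.toTwoPFA.Reaches w t c) :
    M.config w t = c ∧ ∀ r < t, (M.config w r).1 ∉ M.acc ∪ M.rej := by
  induction h with
  | start => exact ⟨rfl, fun r hr => absurd hr (Nat.not_lt_zero r)⟩
  | @step t s i s' d _ hs hd ih =>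
    have hd' : (s', d) = M.δ s (tapeSymbol w i) := by
      by_contra hne
      exact hd (by rw [toTwoPFA, PMF.pure_apply, if_neg hne])
    constructor
    · rw [config_succ, ih.1, step]
      refine (if_neg hs).trans ?_
      rw [← hd']
    · intro r hr
      rcases Nat.lt_succ_iff_lt_or_eq.1 hr with hr | rfl
      · exact ih.2 r hr
      · rw [ih.1]; exact hs

/-- `Reaches` does not continue past a halting configuration, so an accepting computation ends at
the first acceptance. -/
lemma time_toTwoPFA_le (M : TwoDFA α S) (L : Language α) : M.toTwoPFA.time L ≤ M.time L := by
  refine iSup₂_le fun w hw => iSup₂_le fun t ht => ?_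
  obtain ⟨c, hr, hc⟩ := ht
  refine le_iSup₂_of_le w hw (le_iInf₂ fun r hrt => ?_)
  by_contra! hlt
  exact (M.config_of_reaches hr).2 r (by exact_mod_cast hlt) (Or.inl hrt)

end TwoDFA

theorem lower_bound_ts2DFA {n : ℕ} (hn : 1 ≤ n) :
    ENNReal.ofReal (1 / 12 * (n : ℝ) ^ 2) ≤ ts2DFA (languageEQ n) := by
  refine le_iInf fun S => le_iInf fun _ => le_iInf fun M => le_iInf fun hM => ?_
  have hacc (w) (hw : w ∈ languageEQ n) : 1 ≤ M.toTwoPFA.acceptProb w :=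
    M.acceptProb_toTwoPFA_of_accepts (hM.1 w hw)
  have hrej (w) (hw : w ∉ languageEQ n) : M.toTwoPFA.acceptProb w = 0 :=
    M.acceptProb_toTwoPFA_of_rejects (hM.2 w hw)
  have hmem := eqWord_mem_languageEQ_iff.2 (rfl : (fun _ : Fin n => true) = fun _ => true)
  obtain ⟨hS, -⟩ := M.toTwoPFA.two_le_card_and_one_le_time (v := []) hmem
    (zero_lt_one.trans_le (hacc _ hmem)).ne'
    (by rw [hrej _ (nil_notMem_languageEQ hn)]; exact zero_lt_one)
  have hle : M.toTwoPFA.timeSpace (languageEQ n) ≤ M.timeSpace (languageEQ n) :=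
    mul_le_mul_left (ENat.toENNReal_mono (M.time_toTwoPFA_le _)) _
  refine le_trans (M.toTwoPFA.ofReal_le_timeSpace hS fun T hT => ?_) hle
  have := M.toTwoPFA.sq_le_time_mul_logb hn hS (fun w hw t c hr hc => by
    have := M.toTwoPFA.le_time hw hr hc
    rw [hT] at this
    exact_mod_cast this) (fun w hw => (by
      refine lt_of_lt_of_le ?_ (hacc w hw)
      rw [one_div]
      exact ENNReal.inv_lt_one.2 ENNReal.one_lt_two)) hrej
  linarith

/-! ### Automata that sweep once over the tape. -/

lemma tapeSymbol_length_succ {α : Type} (w : List α) :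
    tapeSymbol w (w.length + 1) = TapeSymbol.rightEnd := by
  simp [tapeSymbol]

lemma tapeSymbol_succ_of_lt {α : Type} (w : List α) {i : ℕ} (h : i < w.length) :
    tapeSymbol w (i + 1) = TapeSymbol.letter w[i] := by
  simp [tapeSymbol, h]

lemma foldl_take_succ {α β : Type*} (f : β → α → β) (q : β) (w : List α) {i : ℕ}
    (h : i < w.length) : (w.take (i + 1)).foldl f q = f ((w.take i).foldl f q) w[i] := by
  rw [List.take_succ_eq_append_getElem h, List.foldl_append]
  rfl

/-- The sweep over the tape of a one-way automaton. -/
def sweepMove {α Q : Type} (step : Q → α → Q) (halt : Q → Bool) (q : Q) :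
    TapeSymbol α → (Q ⊕ Bool) × SignType
  | .leftEnd => (Sum.inl q, 1)
  | .letter a => (Sum.inl (step q a), 1)
  | .rightEnd => (Sum.inr (halt q), 0)

lemma sweepMove_leftEnd_ne {α Q : Type} (step : Q → α → Q) (halt : Q → Bool) (q : Q) :
    (sweepMove step halt q .leftEnd).2 ≠ -1 :=
  show (1 : SignType) ≠ -1 by decide

lemma sweepMove_rightEnd_ne {α Q : Type} (step : Q → α → Q) (halt : Q → Bool) (q : Q) :
    (sweepMove step halt q .rightEnd).2 ≠ 1 :=
  show (0 : SignType) ≠ 1 by decide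

lemma disjoint_inr_true_inr_false (Q : Type) :
    Disjoint ({Sum.inr true} : Set (Q ⊕ Bool)) {Sum.inr false} := by simp

lemma inl_notMem_halting {Q : Type} (q : Q) :
    (Sum.inl q : Q ⊕ Bool) ∉ ({Sum.inr true} ∪ {Sum.inr false} : Set (Q ⊕ Bool)) := by simp

lemma inr_mem_halting {Q : Type} (b : Bool) :
    (Sum.inr b : Q ⊕ Bool) ∈ ({Sum.inr true} ∪ {Sum.inr false} : Set (Q ⊕ Bool)) := by
  cases b <;> simp

namespace TwoDFA

variable {α Q : Type}

/-- The two-way automaton that reads its input once from the left to the right. -/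
def sweep (step : Q → α → Q) (halt : Q → Bool) (q₀ : Q) : TwoDFA α (Q ⊕ Bool) where
  δ s a := match s with
    | Sum.inl q => sweepMove step halt q a
    | Sum.inr b => (Sum.inr b, 0)
  start := Sum.inl q₀
  acc := {Sum.inr true}
  rej := {Sum.inr false}
  disjoint_acc_rej := disjoint_inr_true_inr_false Q
  leftEnd_ne s := by
    cases s
    · exact sweepMove_leftEnd_ne _ _ _
    · exact show (0 : SignType) ≠ _ by decide
  rightEnd_ne s := by
    cases s
    · exact sweepMove_rightEnd_ne _ _ _
    · exact show (0 : SignType) ≠ _ by decide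

/-- The first step only leaves the left end-marker, so `t + 1` steps read `t` letters. One more step
at the right end-marker decides, which gives `w.length + 2` in all. -/
lemma config_sweep (step : Q → α → Q) (halt : Q → Bool) (q₀ : Q) (w : List α) (t : ℕ)
    (ht : t ≤ w.length) :
    (sweep step halt q₀).config w (t + 1) = (Sum.inl ((w.take t).foldl step q₀), t + 1) := by
  induction t with
  | zero =>
    rw [config_succ, TwoDFA.step]
    exact if_neg (inl_notMem_halting _)
  | succ t ih =>
    rw [config_succ, ih (by omega), TwoDFA.step, foldl_take_succ _ _ _ ht]
    refine (if_neg (inl_notMem_halting _)).trans ?_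
    simp only [tapeSymbol_succ_of_lt w ht]
    rfl

lemma config_sweep_halt (step : Q → α → Q) (halt : Q → Bool) (q₀ : Q) (w : List α) :
    ((sweep step halt q₀).config w (w.length + 2)).1 = Sum.inr (halt (w.foldl step q₀)) := by
  rw [config_succ, config_sweep _ _ _ _ _ le_rfl, TwoDFA.step, List.take_length]
  refine (congrArg Prod.fst (if_neg (inl_notMem_halting _))).trans ?_
  simp only [tapeSymbol_length_succ]
  rfl

lemma sweep_recognizes (step : Q → α → Q) (halt : Q → Bool) (q₀ : Q) (L : Language α)
    (h : ∀ w, halt (w.foldl step q₀) = true ↔ w ∈ L) : (sweep step halt q₀).Recognizes L := by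
  refine ⟨fun w hw => ⟨w.length + 2, ?_⟩, fun w hw => ⟨w.length + 2, ?_⟩⟩
  · rw [config_sweep_halt, (h w).2 hw]
    rfl
  · rw [config_sweep_halt, Bool.eq_false_iff.2 (mt (h w).1 hw)]
    rfl

lemma time_sweep_le (step : Q → α → Q) (halt : Q → Bool) (q₀ : Q) (L : Language α) (N : ℕ)
    (h : ∀ w, halt (w.foldl step q₀) = true ↔ w ∈ L) (hN : ∀ w ∈ L, w.length + 2 ≤ N) :
    (sweep step halt q₀).time L ≤ N := by
  refine iSup₂_le fun w hw => (iInf₂_le (w.length + 2) ?_).trans (by exact_mod_cast hN w hw)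
  rw [config_sweep_halt, (h w).2 hw]
  rfl

end TwoDFA

namespace TwoPFA

variable {α Q R : Type} [Fintype R] [Nonempty R]

/-- The probabilistic two-way automaton that chooses the initial state of a one-way automaton at
random and then reads its input once from the left to the right. -/
noncomputable def sweep (step : Q → α → Q) (halt : Q → Bool) (init : R → Q) :
    TwoPFA α (Option Q ⊕ Bool) where
  δ s a := match s, a with
    | Sum.inl none, .leftEnd =>
      (PMF.uniformOfFintype R).map fun r => (Sum.inl (some (init r)), 1)
    | Sum.inl (some q), a =>
      PMF.pure (Sum.map some id (sweepMove step halt q a).1, (sweepMove step halt q a).2)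
    -- Irrelevant values: `none` occurs only at the start, on the left end-marker, and `Sum.inr` is
    -- halting.
    | _, _ => PMF.pure (Sum.inr false, 0)
  start := Sum.inl none
  acc := {Sum.inr true}
  rej := {Sum.inr false}
  disjoint_acc_rej := disjoint_inr_true_inr_false _
  leftEnd_eq_zero s s' := by
    rcases s with (_ | q) | b
    · refine (PMF.apply_eq_zero_iff _ _).2 fun h => ?_
      obtain ⟨r, -, hr⟩ := (PMF.mem_support_map_iff _ _ _).1 h
      exact absurd (congrArg Prod.snd hr) (show (1 : SignType) ≠ -1 by decide)
    · rw [PMF.pure_apply, if_neg]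
      exact fun h => sweepMove_leftEnd_ne step halt q (congrArg Prod.snd h).symm
    · rw [PMF.pure_apply, if_neg]
      exact fun h => absurd (congrArg Prod.snd h) (show (-1 : SignType) ≠ 0 by decide)
  rightEnd_eq_zero s s' := by
    rcases s with (_ | q) | b
    · rw [PMF.pure_apply, if_neg]
      exact fun h => absurd (congrArg Prod.snd h) (show (1 : SignType) ≠ 0 by decide)
    · rw [PMF.pure_apply, if_neg]
      exact fun h => sweepMove_rightEnd_ne step halt q (congrArg Prod.snd h).symm
    · rw [PMF.pure_apply, if_neg]
      exact fun h => absurd (congrArg Prod.snd h) (show (1 : SignType) ≠ 0 by decide)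

lemma law_sweep (step : Q → α → Q) (halt : Q → Bool) (init : R → Q) (w : List α) (t : ℕ)
    (ht : t ≤ w.length) :
    (sweep step halt init).law w (t + 1) = (PMF.uniformOfFintype R).map
      fun r => (Sum.inl (some ((w.take t).foldl step (init r))), t + 1) := by
  induction t with
  | zero =>
    rw [law, law, PMF.pure_bind, TwoPFA.step]
    refine (if_neg (inl_notMem_halting _)).trans ?_
    exact PMF.map_comp _ _ _
  | succ t ih =>
    rw [law, ih (by omega), PMF.bind_map, ← PMF.bind_pure_comp]
    congr 1
    funext r
    rw [Function.comp, Function.comp, TwoPFA.step, foldl_take_succ _ _ _ ht]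
    refine (if_neg (inl_notMem_halting _)).trans ?_
    simp only [tapeSymbol_succ_of_lt w ht]
    exact PMF.pure_map _ _

lemma law_sweep_halt (step : Q → α → Q) (halt : Q → Bool) (init : R → Q) (w : List α) (k : ℕ) :
    (sweep step halt init).law w (w.length + 2 + k) = (PMF.uniformOfFintype R).map
      fun r => (Sum.inr (halt (w.foldl step (init r))), w.length + 1) := by
  induction k with
  | zero =>
    rw [add_zero, law, law_sweep _ _ _ _ _ le_rfl, PMF.bind_map, ← PMF.bind_pure_comp,
      List.take_length]
    congr 1
    funext r
    rw [Function.comp, Function.comp, TwoPFA.step]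
    refine (if_neg (inl_notMem_halting _)).trans ?_
    simp only [tapeSymbol_length_succ]
    exact PMF.pure_map _ _
  | succ k ih =>
    rw [← add_assoc, law, ih, PMF.bind_map, ← PMF.bind_pure_comp]
    congr 1
    funext r
    rw [Function.comp, Function.comp, TwoPFA.step]
    exact if_pos (inr_mem_halting _)

lemma acceptProb_sweep [Fintype Q] (step : Q → α → Q) (halt : Q → Bool) (init : R → Q) (w : List α) :
    (sweep step halt init).acceptProb w =
      (PMF.uniformOfFintype R).toOuterMeasure {r | halt (w.foldl step (init r)) = true} := by
  have h (k : ℕ) : (sweep step halt init).acceptProbWithin w (w.length + 2 + k) =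
      (PMF.uniformOfFintype R).toOuterMeasure {r | halt (w.foldl step (init r)) = true} := by
    rw [acceptProbWithin, law_sweep_halt, PMF.toOuterMeasure_map_apply]
    congr 1
    ext r
    simp [sweep]
  refine le_antisymm (iSup_le fun t => ?_) ?_
  · rw [← h t]
    exact acceptProbWithin_mono _ _ (Nat.le_add_left t _)
  · rw [← h 0]
    exact le_iSup _ _

/-- Until it halts, the automaton has its head at the position `t`, whatever the random choice was.
-/
lemma reaches_sweep (step : Q → α → Q) (halt : Q → Bool) (init : R → Q) (w : List α) {t : ℕ}
    {c : (Option Q ⊕ Bool) × ℕ} (h : (sweep step halt init).Reaches w t c) :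
    t ≤ w.length + 2 ∧ ((t = 0 ∧ c = (Sum.inl none, 0)) ∨
      (t ≤ w.length + 1 ∧ ∃ q, c = (Sum.inl (some q), t)) ∨ ∃ b, c.1 = Sum.inr b) := by
  induction h with
  | start => exact ⟨by omega, Or.inl ⟨rfl, rfl⟩⟩
  | @step t s i s' d _ hs hd ih =>
    rw [← PMF.mem_support_iff] at hd
    obtain ⟨-, ⟨rfl, h⟩ | ⟨ht, q, h⟩ | ⟨b, h⟩⟩ := ih
    · obtain ⟨rfl, rfl⟩ := Prod.mk.injEq _ _ _ _ ▸ h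
      obtain ⟨r, -, hr⟩ := (PMF.mem_support_map_iff _ _ _).1 hd
      obtain ⟨rfl, rfl⟩ := Prod.mk.injEq _ _ _ _ ▸ hr
      exact ⟨by omega, Or.inr (Or.inl ⟨by omega, _, rfl⟩)⟩
    · obtain ⟨rfl, rfl⟩ := Prod.mk.injEq _ _ _ _ ▸ h
      refine ⟨by omega, Or.inr ?_⟩
      have hd' := (PMF.mem_support_pure_iff _ _).1 hd
      rcases i with _ | i
      · obtain ⟨rfl, rfl⟩ := Prod.mk.injEq _ _ _ _ ▸ hd'
        exact Or.inl ⟨by omega, _, rfl⟩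
      · rcases Nat.lt_or_ge i w.length with hi | hi
        · rw [tapeSymbol_succ_of_lt w hi] at hd'
          obtain ⟨rfl, rfl⟩ := Prod.mk.injEq _ _ _ _ ▸ hd'
          exact Or.inl ⟨by omega, _, rfl⟩
        · obtain rfl : i = w.length := by omega
          rw [tapeSymbol_length_succ] at hd'
          obtain ⟨rfl, rfl⟩ := Prod.mk.injEq _ _ _ _ ▸ hd'
          exact Or.inr ⟨_, rfl⟩
    · obtain rfl : s = _ := h
      exact absurd (inr_mem_halting b) hs

lemma time_sweep_le (step : Q → α → Q) (halt : Q → Bool) (init : R → Q) (L : Language α) (N : ℕ)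
    (hN : ∀ w ∈ L, w.length + 2 ≤ N) : (sweep step halt init).time L ≤ N := by
  refine iSup₂_le fun w hw => iSup₂_le fun t ht => ?_
  obtain ⟨c, hc, -⟩ := ht
  exact_mod_cast (reaches_sweep step halt init w hc).1.trans (hN w hw)

end TwoPFA

/-! ### Deterministic upper bound: storing the word. -/

lemma ts2DFA_le {α S : Type} [Fintype S] {L : Language α} (M : TwoDFA α S) (hM : M.Recognizes L)
    {T : ℕ} (hT : M.time L ≤ T) {b : ℝ} (hb : T * Real.logb 2 (Fintype.card S) ≤ b) :
    ts2DFA L ≤ ENNReal.ofReal b := by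
  refine (iInf₂_le S ‹_›).trans ((iInf₂_le M hM).trans ?_)
  refine le_trans ?_ (ENNReal.ofReal_le_ofReal hb)
  rw [ENNReal.ofReal_mul (by positivity), ENNReal.ofReal_natCast]
  exact mul_le_mul_left (by exact_mod_cast ENat.toENNReal_mono hT) _

lemma ts2PFA_le {α S : Type} [Fintype S] {L : Language α} {ε : ℝ} (M : TwoPFA α S)
    (hM : M.Recognizes ε L) {T : ℕ} (hT : M.time L ≤ T) {b : ℝ}
    (hb : T * Real.logb 2 (Fintype.card S) ≤ b) : ts2PFA ε L ≤ ENNReal.ofReal b := by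
  refine (iInf₂_le S ‹_›).trans ((iInf₂_le M hM).trans ?_)
  refine le_trans ?_ (ENNReal.ofReal_le_ofReal hb)
  rw [ENNReal.ofReal_mul (by positivity), ENNReal.ofReal_natCast]
  exact mul_le_mul_left (by exact_mod_cast ENat.toENNReal_mono hT) _

/-- The letters are the bits and one more symbol. -/
def letterEquiv : Letter ≃ Option Bool where
  toFun
    | .bit b => some b
    | .hash => none
  invFun
    | some b => .bit b
    | none => .hash
  left_inv a := by cases a <;> rfl
  right_inv a := by cases a <;> rfl

instance : Fintype Letter := Fintype.ofEquiv _ letterEquiv.symm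

lemma card_letter : Fintype.card Letter = 3 := Fintype.card_congr letterEquiv

/-- Append a letter to a word, unless this makes the word longer than `k`. -/
def appendUpTo {α : Type} (k : ℕ) (l : List α) (a : α) : List α := (l ++ [a]).take k

lemma foldl_appendUpTo {α : Type} (k : ℕ) (w : List α) :
    w.foldl (appendUpTo k) [] = w.take k := by
  induction w using List.reverseRecOn with
  | nil => simp
  | append_singleton w a ih =>
    rw [List.foldl_append, ih, List.foldl_cons, List.foldl_nil, appendUpTo, List.take_append,
      List.take_append, List.take_take, List.length_take, min_self]
    congr 1
    rcases le_total k w.length with h | h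
    · simp [h]
    · rw [min_eq_right h]

/-- One letter more than `3n` suffices to notice that a word is too long. -/
lemma take_mem_languageEQ_iff {n : ℕ} {w : List Letter} :
    w.take (3 * n + 1) ∈ languageEQ n ↔ w ∈ languageEQ n := by
  rcases le_or_gt w.length (3 * n + 1) with h | h
  · rw [List.take_of_length_le h]
  · refine iff_of_false (fun hw => ?_) (fun hw => ?_)
    · have := length_of_mem_languageEQ hw
      rw [List.length_take] at this
      omega
    · have := length_of_mem_languageEQ hw
      omega

open Classical in
theorem upper_bound_ts2DFA {n : ℕ} (hn : 1 ≤ n) :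
    ts2DFA (languageEQ n) ≤ ENNReal.ofReal (50 * (n : ℝ) ^ 2) := by
  let K := TwoPFA.shortLists Letter (3 * n + 1)
  let step (q : K) (a : Letter) : K := ⟨appendUpTo (3 * n + 1) q.1 a,
    TwoPFA.mem_shortLists.2 (List.length_take_le _ _)⟩
  let halt (q : K) : Bool := decide (q.1 ∈ languageEQ n)
  let q₀ : K := ⟨[], TwoPFA.mem_shortLists.2 (Nat.zero_le _)⟩
  have hfold (w : List Letter) (q : K) :
      (w.foldl step q).1 = w.foldl (appendUpTo (3 * n + 1)) q.1 := by
    induction w generalizing q with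
    | nil => rfl
    | cons a w ih => exact ih _
  have hL (w : List Letter) : halt (w.foldl step q₀) = true ↔ w ∈ languageEQ n := by
    rw [decide_eq_true_iff, hfold, foldl_appendUpTo, take_mem_languageEQ_iff]
  have hT := TwoDFA.time_sweep_le step halt q₀ _ (3 * n + 2) hL
    (fun w hw => by rw [length_of_mem_languageEQ hw])
  refine ts2DFA_le _ (TwoDFA.sweep_recognizes step halt q₀ _ hL) hT ?_
  -- Base `4` counts the three letters and the padding symbol; the last factor `4` makes room for
  -- the two halting states.
  have hcard : Fintype.card (K ⊕ Bool) ≤ 4 ^ (3 * n + 2) := by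
    have h1 := TwoPFA.card_shortLists_le (S := Letter) (3 * n + 1)
    rw [card_letter] at h1
    rw [Fintype.card_sum, Fintype.card_coe, Fintype.card_bool, pow_succ]
    have : 1 ≤ 4 ^ (3 * n + 1) := Nat.one_le_pow _ _ (by norm_num)
    have h2 : K.card ≤ 4 ^ (3 * n + 1) := h1
    omega
  have hlog : Real.logb 2 (Fintype.card (K ⊕ Bool)) ≤ 2 * (3 * n + 2) := by
    have h0 : (0 : ℝ) < Fintype.card (K ⊕ Bool) := by exact_mod_cast Fintype.card_pos
    rw [Real.logb_le_iff_le_rpow one_lt_two h0]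
    have : (4 : ℝ) ^ (3 * n + 2) = 2 ^ (2 * (3 * (n : ℝ) + 2)) := by
      rw [Real.rpow_mul (by norm_num)]
      norm_num
      exact_mod_cast (Real.rpow_natCast (4 : ℝ) (3 * n + 2)).symm
    rw [← this]
    exact_mod_cast hcard
  have hn' : (1 : ℝ) ≤ n := by exact_mod_cast hn
  push_cast
  calc (3 * (n : ℝ) + 2) * Real.logb 2 (Fintype.card (K ⊕ Bool))
      ≤ (3 * n + 2) * (2 * (3 * n + 2)) := by gcongr
    _ ≤ (5 * n) * (2 * (5 * n)) := by gcongr <;> linarith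
    _ = 50 * (n : ℝ) ^ 2 := by ring

/-! ### Probabilistic upper bound: polynomial fingerprints. -/

/-- Whether the letter `a` may stand at the position `k` of a word `x #ⁿ y`. -/
def fitsEqWord (n k : ℕ) : Letter → Bool
  | .bit _ => decide (k < n ∨ 2 * n ≤ k)
  | .hash => decide (n ≤ k ∧ k < 2 * n)

/-- The contribution of the letter `a` at the position `k` of a word `x #ⁿ y` to the value at `r` of
the polynomial with the coefficients `xᵢ - yᵢ`. -/
def eqWordTerm {A : Type*} [Ring A] (n k : ℕ) (r : A) : Letter → A
  | .bit b => if k < n then b.toNat * r ^ k else -(b.toNat * r ^ (k - 2 * n))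
  | .hash => 0

/-- Fingerprinting: a state holds the number of the letters that have been read (up to `3n`), whether
these letters fit, the sum of their contributions and the point `r`. -/
def fingerprintStep {A : Type*} [Ring A] (n : ℕ) (q : Fin (3 * n + 1) × Bool × A × A) (a : Letter) :
    Fin (3 * n + 1) × Bool × A × A :=
  if h : q.1.val + 1 < 3 * n + 1 then
    (⟨q.1.val + 1, h⟩, q.2.1 && fitsEqWord n q.1 a, q.2.2.1 + eqWordTerm n q.1 q.2.2.2 a, q.2.2.2)
  -- The counter is saturated at `3n`, so the word is too long and the flag stays `false` from here
  -- on.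
  else (q.1, false, q.2.2.1, q.2.2.2)

section fingerprint

variable {A : Type*} [Ring A] (n : ℕ) (r : A)

/-- The state after the word `w`. -/
def fingerprint (w : List Letter) : Fin (3 * n + 1) × Bool × A × A :=
  w.foldl (fingerprintStep n) (0, true, 0, r)

lemma fingerprint_append_singleton (w : List Letter) (a : Letter) :
    fingerprint n r (w ++ [a]) = fingerprintStep n (fingerprint n r w) a := by
  simp [fingerprint]

lemma fingerprint_spec (w : List Letter) :
    (w.length ≤ 3 * n →
      (fingerprint n r w).1.val = w.length ∧
      ((fingerprint n r w).2.1 = true ↔ ∀ k a, w[k]? = some a → fitsEqWord n k a = true) ∧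
      (fingerprint n r w).2.2.1 =
        ∑ k ∈ Finset.range w.length, (w[k]?).elim 0 (eqWordTerm n k r) ∧
      (fingerprint n r w).2.2.2 = r) ∧
    (3 * n < w.length → (fingerprint n r w).1.val = 3 * n ∧ (fingerprint n r w).2.1 = false) := by
  induction w using List.reverseRecOn with
  | nil => simp [fingerprint]
  | append_singleton w a ih =>
    rw [fingerprint_append_singleton, fingerprintStep, List.length_append, List.length_singleton]
    constructor
    · intro hlen
      obtain ⟨h1, h2, h3, h4⟩ := ih.1 (by omega)
      rw [dif_pos (by omega)]
      refine ⟨by simp [h1], ?_, ?_, h4⟩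
      · rw [Bool.and_eq_true, h2, h1]
        constructor
        · rintro ⟨hw, ha⟩ k b hk
          rcases lt_trichotomy k w.length with hlt | rfl | hgt
          · rw [List.getElem?_append_left hlt] at hk
            exact hw k b hk
          · simp only [List.getElem?_concat_length, Option.some.injEq] at hk
            exact hk ▸ ha
          · rw [List.getElem?_eq_none (by simp; omega)] at hk
            cases hk
        · intro h
          refine ⟨fun k b hk => h k b ?_, h _ a (by simp)⟩
          obtain ⟨hlt, -⟩ := List.getElem?_eq_some_iff.1 hk
          rwa [List.getElem?_append_left hlt]
      · rw [Finset.sum_range_succ, h3, h4]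
        dsimp only
        rw [h1]
        congr 1
        · refine Finset.sum_congr rfl fun k hk => ?_
          rw [List.getElem?_append_left (Finset.mem_range.1 hk)]
        · simp
    · intro hlen
      have h1 : (fingerprint n r w).1.val = 3 * n := by
        rcases Nat.lt_or_ge (3 * n) w.length with h | h
        · exact (ih.2 h).1
        · rw [(ih.1 h).1]; omega
      rw [dif_neg (by omega)]
      exact ⟨h1, rfl⟩

end fingerprint

lemma getElem?_eqWord {n : ℕ} (x y : Fin n → Bool) (k : ℕ) :
    (∀ h : k < n, (eqWord x y)[k]? = some (.bit (x ⟨k, h⟩))) ∧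
    (k < n → (eqWord x y)[n + k]? = some .hash) ∧
    (∀ h : k < n, (eqWord x y)[n + n + k]? = some (.bit (y ⟨k, h⟩))) := by
  refine ⟨fun h => ?_, fun h => ?_, fun h => ?_⟩
  · rw [eqWord, List.getElem?_append_left (by simp; omega), List.getElem?_append_left (by simp; omega)]
    simp [h]
  · rw [eqWord, List.getElem?_append_left (by simp; omega),
      List.getElem?_append_right (by simp)]
    simp [h]
  · rw [eqWord, List.getElem?_append_right (by simp)]
    simp [h]

lemma eq_eqWord_of_fits {n : ℕ} {w : List Letter} (hw : w.length = 3 * n)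
    (h : ∀ k a, w[k]? = some a → fitsEqWord n k a = true) : ∃ x y : Fin n → Bool, w = eqWord x y := by
  have hbit (k : ℕ) (hk : k < 3 * n) (hk' : k < n ∨ 2 * n ≤ k) : ∃ b, w[k]? = some (.bit b) := by
    rcases hwk : w[k]? with _ | (b | _)
    · rw [List.getElem?_eq_none_iff] at hwk; omega
    · exact ⟨b, rfl⟩
    · have := h _ _ hwk
      simp only [fitsEqWord, decide_eq_true_eq] at this
      omega
  have hx (i : Fin n) := hbit i (by omega) (by omega)
  have hy (i : Fin n) := hbit (n + n + i) (by omega) (by omega)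
  choose x hx using hx
  choose y hy using hy
  refine ⟨x, y, List.ext_getElem? fun k => ?_⟩
  rcases Nat.lt_or_ge k n with hk | hk
  · rw [(getElem?_eqWord x y k).1 hk, ← hx ⟨k, hk⟩]
  obtain ⟨k, rfl⟩ := Nat.exists_eq_add_of_le hk
  rcases Nat.lt_or_ge k n with hk | hk
  · rw [(getElem?_eqWord x y k).2.1 hk]
    rcases hwk : w[n + k]? with _ | (b | _)
    · rw [List.getElem?_eq_none_iff] at hwk; omega
    · have := h _ _ hwk
      simp only [fitsEqWord, decide_eq_true_eq] at this
      omega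
    · rfl
  obtain ⟨k, rfl⟩ := Nat.exists_eq_add_of_le hk
  rw [← add_assoc]
  rcases Nat.lt_or_ge k n with hk | hk
  · rw [(getElem?_eqWord x y k).2.2 hk, ← hy ⟨k, hk⟩]
  · rw [List.getElem?_eq_none (by omega), List.getElem?_eq_none (by simp [eqWord]; omega)]

lemma eqWord_fits {n : ℕ} (x y : Fin n → Bool) (k : ℕ) (a : Letter)
    (h : (eqWord x y)[k]? = some a) : fitsEqWord n k a = true := by
  rcases Nat.lt_or_ge k n with hk | hk
  · rw [(getElem?_eqWord x y k).1 hk, Option.some.injEq] at h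
    subst h
    simp [fitsEqWord, hk]
  obtain ⟨k, rfl⟩ := Nat.exists_eq_add_of_le hk
  rcases Nat.lt_or_ge k n with hk | hk
  · rw [(getElem?_eqWord x y k).2.1 hk, Option.some.injEq] at h
    subst h
    simp only [fitsEqWord, decide_eq_true_eq]
    omega
  obtain ⟨k, rfl⟩ := Nat.exists_eq_add_of_le hk
  rw [← add_assoc] at h ⊢
  rcases Nat.lt_or_ge k n with hk | hk
  · rw [(getElem?_eqWord x y k).2.2 hk, Option.some.injEq] at h
    subst h
    simp only [fitsEqWord, decide_eq_true_eq]
    omega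
  · rw [List.getElem?_eq_none (by simp [eqWord]; omega)] at h
    cases h

open Polynomial in
/-- The polynomial with the coefficients `xᵢ - yᵢ`. -/
noncomputable def differencePolynomial (A : Type*) [Ring A] {n : ℕ} (x y : Fin n → Bool) : A[X] :=
  ∑ i : Fin n, C (((x i).toNat : A) - (y i).toNat) * X ^ (i : ℕ)

lemma sum_eqWordTerm {A : Type*} [CommRing A] {n : ℕ} (r : A) (x y : Fin n → Bool) :
    ∑ k ∈ Finset.range (3 * n), ((eqWord x y)[k]?).elim 0 (eqWordTerm n k r) =
      (differencePolynomial A x y).eval r := by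
  rw [show 3 * n = n + n + n by ring, Finset.sum_range_add, Finset.sum_range_add]
  have h2 : ∑ k ∈ Finset.range n, ((eqWord x y)[n + k]?).elim 0 (eqWordTerm n (n + k) r) = 0 := by
    refine Finset.sum_eq_zero fun k hk => ?_
    rw [(getElem?_eqWord x y k).2.1 (Finset.mem_range.1 hk)]
    rfl
  rw [h2, add_zero, Finset.sum_range, Finset.sum_range, ← Finset.sum_add_distrib,
    differencePolynomial, Polynomial.eval_finsetSum]
  refine Finset.sum_congr rfl fun i _ => ?_
  rw [(getElem?_eqWord x y i).1 i.2, (getElem?_eqWord x y i).2.2 i.2]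
  have h1 : ¬ n + n + (i : ℕ) < n := by omega
  have h3 : n + n + (i : ℕ) - 2 * n = i := by omega
  simp only [Option.elim, eqWordTerm, i.2, if_true, h1, if_false, h3, Polynomial.eval_mul,
    Polynomial.eval_C, Polynomial.eval_pow, Polynomial.eval_X]
  ring

/-- The decision of the fingerprinting automaton. -/
def fingerprintHalt {A : Type*} [Ring A] [DecidableEq A] (n : ℕ)
    (q : Fin (3 * n + 1) × Bool × A × A) : Bool :=
  decide (q.1.val = 3 * n) && (q.2.1 && decide (q.2.2.1 = 0))

lemma fingerprintHalt_iff {A : Type*} [CommRing A] [DecidableEq A] (n : ℕ) (r : A)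
    (w : List Letter) : fingerprintHalt n (fingerprint n r w) = true ↔
      ∃ x y : Fin n → Bool, w = eqWord x y ∧ (differencePolynomial A x y).eval r = 0 := by
  simp only [fingerprintHalt, Bool.and_eq_true, decide_eq_true_eq]
  constructor
  · rintro ⟨h1, h2, h3⟩
    have hlen : w.length ≤ 3 * n := by
      by_contra! h
      rw [((fingerprint_spec n r w).2 h).2] at h2
      cases h2
    obtain ⟨s1, s2, s3, -⟩ := (fingerprint_spec n r w).1 hlen
    have hlen' : w.length = 3 * n := s1.symm.trans h1
    obtain ⟨x, y, rfl⟩ := eq_eqWord_of_fits hlen' (s2.1 h2)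
    refine ⟨x, y, rfl, ?_⟩
    rw [← sum_eqWordTerm, ← hlen', ← s3, h3]
  · rintro ⟨x, y, rfl, h⟩
    have hlen : (eqWord x y).length = 3 * n := by simp [eqWord]; omega
    obtain ⟨s1, s2, s3, -⟩ := (fingerprint_spec n r (eqWord x y)).1 hlen.le
    exact ⟨s1.trans hlen, s2.2 (eqWord_fits x y), by rw [s3, hlen, sum_eqWordTerm, h]⟩

lemma differencePolynomial_self (A : Type*) [Ring A] {n : ℕ} (x : Fin n → Bool) :
    differencePolynomial A x x = 0 := by
  simp [differencePolynomial]

/-- A coefficient at which `x` and `y` differ is `1` or `-1`, hence nonzero in any characteristic.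
-/
lemma differencePolynomial_ne_zero (A : Type*) [Ring A] [Nontrivial A] {n : ℕ}
    {x y : Fin n → Bool} (h : x ≠ y) : differencePolynomial A x y ≠ 0 := by
  obtain ⟨i, hi⟩ := Function.ne_iff.1 h
  intro h0
  have h1 := congrArg (fun p => p.coeff (i : ℕ)) h0
  simp only [differencePolynomial, Polynomial.finsetSum_coeff, Polynomial.coeff_C_mul,
    Polynomial.coeff_X_pow, Polynomial.coeff_zero, Fin.val_inj, mul_ite, mul_one, mul_zero,
    Finset.sum_ite_eq, Finset.mem_univ, if_true] at h1
  rcases hx : x i <;> rcases hy : y i <;> simp_all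

lemma card_roots_differencePolynomial_le {A : Type*} [CommRing A] [IsDomain A] [Fintype A]
    [DecidableEq A] {n : ℕ} {x y : Fin n → Bool} (h : x ≠ y) :
    (Finset.univ.filter fun r : A => (differencePolynomial A x y).eval r = 0).card ≤ n := by
  have h0 := differencePolynomial_ne_zero A h
  calc _ ≤ (differencePolynomial A x y).roots.toFinset.card := by
        refine Finset.card_le_card fun r hr => ?_
        rw [Multiset.mem_toFinset, Polynomial.mem_roots h0]
        exact (Finset.mem_filter.1 hr).2
    _ ≤ (differencePolynomial A x y).roots.card := Multiset.toFinset_card_le _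
    _ ≤ (differencePolynomial A x y).natDegree := Polynomial.card_roots' _
    _ ≤ n := Polynomial.natDegree_le_of_degree_le (Polynomial.degree_sum_fin_lt _).le

/-- The fingerprinting automaton over the field with `p` elements. -/
noncomputable def fingerprintPFA (n p : ℕ) [NeZero p] :
    TwoPFA Letter (Option (Fin (3 * n + 1) × Bool × ZMod p × ZMod p) ⊕ Bool) :=
  TwoPFA.sweep (fingerprintStep n) (fingerprintHalt n) fun r : ZMod p => (0, true, 0, r)

/-- Words of the wrong shape are never accepted. If `x ≠ y`, acceptance requires `r` to be one of at
most `n` roots, which has probability at most `n / p ≤ ε`. -/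
lemma fingerprintPFA_recognizes {n p : ℕ} [Fact p.Prime] {ε : ℝ} (hε : 0 < ε)
    (hp : n ≤ ε * p) : (fingerprintPFA n p).Recognizes ε (languageEQ n) := by
  have hacc (w : List Letter) : (fingerprintPFA n p).acceptProb w =
      (PMF.uniformOfFintype (ZMod p)).toOuterMeasure {r | ∃ x y : Fin n → Bool, w = eqWord x y ∧
        (differencePolynomial (ZMod p) x y).eval r = 0} := by
    rw [fingerprintPFA, TwoPFA.acceptProb_sweep]
    simp only [← fingerprintHalt_iff]
    rfl
  constructor
  · intro w hw
    obtain ⟨x, rfl⟩ := mem_languageEQ_iff.1 hw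
    have : (fingerprintPFA n p).acceptProb (eqWord x x) = 1 := by
      rw [hacc, PMF.toOuterMeasure_apply_eq_one_iff]
      exact fun r _ => ⟨x, x, rfl, by rw [differencePolynomial_self, Polynomial.eval_zero]⟩
    rw [this, ENNReal.ofReal_le_one]
    linarith
  · intro w hw
    rw [hacc]
    by_cases hex : ∃ x y : Fin n → Bool, w = eqWord x y
    · obtain ⟨x, y, rfl⟩ := hex
      have hxy : x ≠ y := mt eqWord_mem_languageEQ_iff.2 hw
      have hp0 : (0 : ℝ) < p := by exact_mod_cast (Fact.out : p.Prime).pos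
      calc _ ≤ (PMF.uniformOfFintype (ZMod p)).toOuterMeasure
            {r | (differencePolynomial (ZMod p) x y).eval r = 0} := by
            refine MeasureTheory.measure_mono ?_
            rintro r ⟨x', y', h, hr⟩
            obtain ⟨rfl, rfl⟩ := eqWord_injective h
            exact hr
        _ = ((Finset.univ.filter fun r : ZMod p =>
              (differencePolynomial (ZMod p) x y).eval r = 0).card : ℝ≥0∞) / p := by
            rw [PMF.toOuterMeasure_uniformOfFintype_apply, ZMod.card, Fintype.card_subtype]
            rfl
        _ ≤ n / p := by
            gcongr
            exact card_roots_differencePolynomial_le hxy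
        _ ≤ ENNReal.ofReal ε := by
            rw [← ENNReal.ofReal_natCast, ← ENNReal.ofReal_natCast, ← ENNReal.ofReal_div_of_pos hp0]
            exact ENNReal.ofReal_le_ofReal ((div_le_iff₀ hp0).2 hp)
    · refine le_trans (le_of_eq ?_) zero_le
      rw [PMF.toOuterMeasure_apply_eq_zero_iff, Set.disjoint_right]
      rintro r ⟨x, y, h, -⟩
      exact absurd ⟨x, y, h⟩ hex

theorem exists_upper_bound_ts2PFA {ε : ℝ} (hε : 0 < ε) :
    ∃ C : ℝ, 0 < C ∧ ∀ n : ℕ, 2 ≤ n →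
      ts2PFA ε (languageEQ n) ≤ ENNReal.ofReal (C * ((n : ℝ) * Real.logb 2 n)) := by
  set a : ℝ := 2 / ε + 2 with ha
  have ha1 : 1 ≤ a := by
    have : 0 < 2 / ε := by positivity
    linarith
  have hL0 : 0 ≤ Real.logb 2 (11 * a ^ 2) := Real.logb_nonneg one_lt_two (by nlinarith)
  refine ⟨4 * (3 + Real.logb 2 (11 * a ^ 2)), by positivity, fun n hn => ?_⟩
  have hn' : (2 : ℝ) ≤ n := by exact_mod_cast hn
  have hn0 : (0 : ℝ) < n := by linarith
  have hlogn : 1 ≤ Real.logb 2 n := by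
    rwa [Real.le_logb_iff_rpow_le one_lt_two hn0, Real.rpow_one]
  -- Bertrand's postulate: `p` is large enough for the error `ε` and still linear in `n`, so that
  -- the `O(n p²)` states have a logarithm of order `log n`.
  obtain ⟨p, hp, hp1, hp2⟩ := Nat.exists_prime_lt_and_le_two_mul ⌈n / ε⌉₊
    (Nat.ceil_pos.2 (by positivity)).ne'
  have : Fact p.Prime := ⟨hp⟩
  have hpn : (n : ℝ) ≤ ε * p := by
    have h1 : (n : ℝ) / ε ≤ p := (Nat.le_ceil _).trans (by exact_mod_cast hp1.le)
    rw [div_le_iff₀ hε] at h1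
    linarith
  have hpa : (p : ℝ) ≤ a * n := by
    have h1 : (p : ℝ) ≤ 2 * ⌈n / ε⌉₊ := by exact_mod_cast hp2
    have h2 := (Nat.ceil_lt_add_one (by positivity : 0 ≤ n / ε)).le
    calc (p : ℝ) ≤ 2 * (n / ε + 1) := by linarith
      _ ≤ 2 * (n / ε + n) := by gcongr; linarith
      _ = a * n := by rw [ha]; ring
  have hT : (fingerprintPFA n p).time (languageEQ n) ≤ (3 * n + 2 : ℕ) :=
    TwoPFA.time_sweep_le _ _ _ _ _ fun w hw => by rw [length_of_mem_languageEQ hw]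
  refine ts2PFA_le _ (fingerprintPFA_recognizes hε hpn) hT ?_
  have hcard : (Fintype.card (Option (Fin (3 * n + 1) × Bool × ZMod p × ZMod p) ⊕ Bool) : ℝ) ≤
      11 * a ^ 2 * n ^ 3 := by
    simp only [Fintype.card_sum, Fintype.card_option, Fintype.card_prod, Fintype.card_fin,
      Fintype.card_bool, ZMod.card]
    push_cast
    have h1 : 1 ≤ a ^ 2 * n ^ 3 := one_le_mul_of_one_le_of_one_le (one_le_pow₀ ha1)
      (one_le_pow₀ (by linarith))
    calc (3 * (n : ℝ) + 1) * (2 * (p * p)) + 1 + 2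
        ≤ (3 * n + n) * (2 * ((a * n) * (a * n))) + 3 := by
          have : (3 * (n : ℝ) + 1) * (2 * (p * p)) ≤ (3 * n + n) * (2 * ((a * n) * (a * n))) := by
            gcongr; linarith
          linarith
      _ = 8 * (a ^ 2 * n ^ 3) + 3 := by ring
      _ ≤ 11 * a ^ 2 * n ^ 3 := by linarith
  have hlog := Real.logb_le_logb_of_le one_lt_two (by exact_mod_cast Fintype.card_pos) hcard
  rw [Real.logb_mul (by positivity) (by positivity), Real.logb_pow] at hlog
  push_cast at hlog ⊢
  calc _ ≤ (3 * (n : ℝ) + 2) * (Real.logb 2 (11 * a ^ 2) + 3 * Real.logb 2 n) := by gcongr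
    -- Both `3n + 2 ≤ 4n` and `1 ≤ log n`, which absorbs the constant term, come from `n ≥ 2`.
    _ ≤ (4 * n) * (Real.logb 2 (11 * a ^ 2) * Real.logb 2 n + 3 * Real.logb 2 n) := by
        gcongr
        · linarith
        · exact le_mul_of_one_le_right hL0 hlogn
    _ = _ := by ring

theorem mainTheorem5 :
    (∃ c C : ℝ, 0 < c ∧ 0 < C ∧ ∀ n : ℕ, 1 ≤ n →
      ENNReal.ofReal (c * (n : ℝ) ^ 2) ≤ ts2DFA (languageEQ n) ∧
        ts2DFA (languageEQ n) ≤ ENNReal.ofReal (C * (n : ℝ) ^ 2)) ∧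
    (∀ ε : ℝ, 0 < ε → ε < 1 / 2 → ∃ c C : ℝ, 0 < c ∧ 0 < C ∧ ∀ n : ℕ, 2 ≤ n →
      ENNReal.ofReal (c * ((n : ℝ) * Real.logb 2 n)) ≤ ts2PFA ε (languageEQ n) ∧
        ts2PFA ε (languageEQ n) ≤ ENNReal.ofReal (C * ((n : ℝ) * Real.logb 2 n))) := by
  refine ⟨⟨1 / 12, 50, by norm_num, by norm_num, fun n hn =>
    ⟨lower_bound_ts2DFA hn, upper_bound_ts2DFA hn⟩⟩, fun ε hε hε' => ?_⟩
  obtain ⟨c, hc, hlower⟩ := exists_lower_bound_ts2PFA hε hε'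
  obtain ⟨C, hC, hupper⟩ := exists_upper_bound_ts2PFA hε
  exact ⟨c, C, hc, hC, fun n hn => ⟨hlower n hn, hupper n hn⟩⟩
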